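/- **Setting.** A rational number is represented as a pair $(a,b)$ of integers written in binary, $b\neq 0$, standing for $a/b$ (not necessarily in lowest terms). An integer $a$ is represented in unary by its sign and a string of length $|a|$. For a matrix $\mathbf M\in\mathbb Q^{n\times m}$, a ranking function $r$ yields a permutation $r(\mathbf M)$ of $\{1,\dots,n\}$, where $r(\mathbf M)(i)$ is the position of row $i$. The ranking functions $r_{\mathsf{Max}}^{\mathsf{asc}}$ and $r_{\mathsf{Max}}^{\mathsf{dsc}}$ order the rows by increasing, respectively decreasing, maximum entry; $r_{\mathsf{Sum}}$ orders them by increasing sum of entries; $r_{\mathsf{Lex}}$ orders them by the left-to-right lexicographic order, ascending in every column. In all cases ties are broken in favour of the smaller row index. For a ranking function $r$, the *precedence problem* $\mathrm{PREC}\langle r\rangle$ is the following. The input is a matrix $\mathbf M$ with two rows and $m$ columns, and finite probability distributions $\Pi_1,\dots,\Pi_m$ over $\mathbb Q$, each given as a list of value-probability pairs. Let $\mathbf u=(u_1,\dots,u_m)$ with the weights $u_j\sim\Pi_j$ independent, and let $\mathbf M\circ\mathbf u$ be the matrix obtained from $\mathbf M$ by multiplying the $j$-th column by $u_j$ for every $j$.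 The task is to compute $$\mathbb P_{\mathbf u\sim\Pi_1\times\dots\times\Pi_m}\bigl[s(1)<s(2)\bigr],\qquad s=r(\mathbf M\circ\mathbf u),$$ the probability that the first row precedes the second. **Theorem.** The problems $\mathrm{PREC}\langle r_{\mathsf{Max}}^{\mathsf{asc}}\rangle$, $\mathrm{PREC}\langle r_{\mathsf{Max}}^{\mathsf{dsc}}\rangle$ and $\mathrm{PREC}\langle r_{\mathsf{Lex}}\rangle$ are solvable in polynomial time. The problem $\mathrm{PREC}\langle r_{\mathsf{Sum}}\rangle$ is solvable in polynomial time if the entries of $\mathbf M$ and the weights in the supports of the $\Pi_j$ are integers encoded in unary (the probabilities being still pairs of binary integers). -/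

import Mathlib

namespace Prec

/-! ### Ranking functions -/

/-- A ranking function maps every rational `n × m` matrix to a permutation of its row indices;
`r n m M i` is the position of row `i`, so row `i` precedes row `i'` iff
`r n m M i < r n m M i'`. -/
abbrev RankingFunction : Type :=
  (n m : ℕ) → Matrix (Fin n) (Fin m) ℚ → Equiv.Perm (Fin n)

/-- Positions of the rows when they are sorted by increasing `key`, ties being broken by the row
index. (`Tuple.sort key` sends a position to the row that occupies it.) -/
def rankByKey {α : Type} [LinearOrder α] {n : ℕ} (key : Fin n → α) : Equiv.Perm (Fin n) :=
  (Tuple.sort key)⁻¹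

/-- The `Max` score of a row; the maximum of a row without entries is `⊥`. -/
def scoreMax {m : ℕ} (a : Fin m → ℚ) : WithBot ℚ := (Finset.univ.image a).max

/-- The `Sum` score of a row. -/
def scoreSum {m : ℕ} (a : Fin m → ℚ) : ℚ := ∑ j, a j

/-- Ranking by increasing `Max`. -/
def rankMaxAsc : RankingFunction := fun _ _ M => rankByKey fun i => scoreMax (M i)

/-- Ranking by decreasing `Max` (ties are still broken by increasing row index). -/
def rankMaxDsc : RankingFunction := fun _ _ M =>
  rankByKey fun i => OrderDual.toDual (scoreMax (M i))

/-- Ranking by increasing `Sum`. -/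
def rankSum : RankingFunction := fun _ _ M => rankByKey fun i => scoreSum (M i)

/-- Ranking by the left-to-right lexicographic order on the rows, ascending in every column. -/
noncomputable def rankLex : RankingFunction := fun _ _ M => rankByKey fun i => toLex (M i)

/-! ### Representations of numbers -/

/-- The alphabet of the encodings. -/
inductive Symbol
  | bit (b : Bool)
  | slash
  | comma
  | semicolon
  deriving DecidableEq, Fintype

/-- A format in which numbers are written down. -/
class NumberFormat (V : Type) where
  /-- the rational number represented -/
  toRat : V → ℚ
  /-- the string that represents it -/
  encode : V → List Symbol

/-- Binary encoding of an integer: a sign bit, then the binary digits of the absolute value. -/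
def encodeBinaryInt (a : ℤ) : List Symbol :=
  Symbol.bit (decide (a < 0)) :: (Computability.encodeNat a.natAbs).map Symbol.bit

/-- Unary encoding of an integer: a sign bit, then `|a|` copies of the digit one. -/
def encodeUnaryInt (a : ℤ) : List Symbol :=
  Symbol.bit (decide (a < 0)) :: List.replicate a.natAbs (Symbol.bit true)

/-- A pair `(a, b)` of integers, `b ≠ 0`, not necessarily coprime, standing for `a / b`. -/
structure Fraction where
  num : ℤ
  den : ℤ
  den_ne_zero : den ≠ 0

/-- Fractions are written as numerator and denominator, both in binary. -/
instance : NumberFormat Fraction where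
  toRat q := (q.num : ℚ) / (q.den : ℚ)
  encode q := encodeBinaryInt q.num ++ Symbol.slash :: encodeBinaryInt q.den

/-- An integer that is to be written in unary. -/
structure UnaryInt where
  toInt : ℤ

instance : NumberFormat UnaryInt where
  toRat a := (a.toInt : ℚ)
  encode a := encodeUnaryInt a.toInt

/-! ### Distributions and inputs -/

/-- A finite probability distribution over `ℚ`, given as a list of value-probability pairs.
The values are in format `V`, the probabilities are binary fractions. -/
structure FiniteDist (V : Type) where
  pairs : List (V × Fraction)
  prob_nonneg : ∀ e ∈ pairs, 0 ≤ NumberFormat.toRat e.2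
  prob_sum : (pairs.map fun e => NumberFormat.toRat e.2).sum = 1

namespace FiniteDist

variable {V : Type} [NumberFormat V]

/-- The probability of the value `q` (if `q` is listed several times, the listed probabilities
add up). -/
def mass (d : FiniteDist V) (q : ℚ) : ℚ :=
  ((d.pairs.filter fun e => NumberFormat.toRat e.1 = q).map fun e => NumberFormat.toRat e.2).sum

/-- The finite set of listed values. -/
def values (d : FiniteDist V) : Finset ℚ :=
  (d.pairs.map fun e => NumberFormat.toRat e.1).toFinset

end FiniteDist

/-- An input of the precedence problem: a matrix with two rows and any number of columns, and one
weight distribution for each column. -/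
structure Input (V : Type) where
  cols : ℕ
  matrix : Matrix (Fin 2) (Fin cols) V
  dist : Fin cols → FiniteDist V

namespace Input

variable {V : Type} [NumberFormat V]

/-- The rational matrix of which the `j`-th column is multiplied by `u j`. -/
def weighted (x : Input V) (u : Fin x.cols → ℚ) : Matrix (Fin 2) (Fin x.cols) ℚ :=
  Matrix.of fun i j => NumberFormat.toRat (x.matrix i j) * u j

/-- The probability, over independent weights `u j` distributed according to `x.dist j`, that the
first row precedes the second one in the ranking of the weighted matrix. -/
def precProb (r : RankingFunction) (x : Input V) : ℚ :=
  ∑ u ∈ Fintype.piFinset fun j => (x.dist j).values,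
    if r 2 x.cols (x.weighted u) 0 < r 2 x.cols (x.weighted u) 1 then
      ∏ j, (x.dist j).mass (u j)
    else 0

/-- A column is written as its two matrix entries followed by the value-probability pairs of its
distribution, every number being closed by a comma and the column by a semicolon. -/
def encodeColumn (x : Input V) (j : Fin x.cols) : List Symbol :=
  NumberFormat.encode (x.matrix 0 j) ++ Symbol.comma ::
    (NumberFormat.encode (x.matrix 1 j) ++ Symbol.comma ::
      ((x.dist j).pairs.flatMap fun e =>
        NumberFormat.encode e.1 ++ Symbol.comma ::
          (NumberFormat.encode e.2 ++ [Symbol.comma])) ++ [Symbol.semicolon])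

/-- An input is written column by column. -/
def encode (x : Input V) : List Symbol :=
  (List.ofFn x.encodeColumn).flatten

end Input

/-- The problem of computing the number `value x` from the input `x` is solvable in polynomial
time: some Turing machine, on every input, outputs within a number of steps polynomial in the
length of the input string some fraction that represents `value x`. -/
def SolvableInPolyTime {I : Type} (encode : I → List Symbol) (value : I → ℚ) : Prop :=
  ∃ f : I → Fraction,
    (∀ x, NumberFormat.toRat (f x) = value x) ∧
      Nonempty (Turing.TM2ComputableInPolyTime encode
        (NumberFormat.encode : Fraction → List Symbol) f)

/-- The precedence problem for the ranking function `r`, with matrix entries and weights in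
format `V`, is solvable in polynomial time. -/
def PrecInPolyTime (V : Type) [NumberFormat V] (r : RankingFunction) : Prop :=
  SolvableInPolyTime (Input.encode : Input V → List Symbol) (Input.precProb r)

end Prec

/-! The precedence probability is computed by a dynamic program over the columns. A pair of scores,
one for each row, decides which row comes first, and it can be updated one column at a time: the two
maxima, the two sums, or, for Lex, the two entries in the leftmost column where the rows differ.
Running through the columns from right to left, the program keeps the distribution of this pair in a
table with one line for each distinct pair, integer numerators and one common denominator. The
numerators of the accepting pairs, added up, over the denominator are the answer; no fraction is
ever reduced.

The table stays polynomial for two reasons. Bit lengths at most add under multiplication, so the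
denominator and the sum of all numerators have polynomially many bits (`sz_total_le`). And few pairs
occur: for Max and Lex each score is initial or the product of an entry with a listed weight, so the
pairs lie in the square of a polynomial list (`PT.solve_of_mem`); for Sum in unary, the partial sums
are differences of natural numbers bounded by a polynomial in the input length
(`PT.solve_addScores`).

For correctness, `integral_table` equates the table with a recursively defined expected value,
`expect_decodedColumn` identifies that value with the sum over the product of the supports,
`foldr_maxScores`, `foldr_addScores` and `foldr_lexScores` interpret the final pair, and
`rankByKey_lt` reduces the order of two rows to a comparison of keys. `precInPolyTime` assembles
this.

The time bound has to hold for actual machines. Structured stack programs are compiled to machines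
(`Run.reaches`), data are coded as binary trees with self-delimiting strings, and the class `PT` is
shown to be closed under composition, pairing, case distinction, bounded iteration (`PT.iterate`)
and linear recursion (`PT.linearRec`). Arithmetic, parsing and the table are then built inside this
class. -/

/-! ### A structured language for stack machines -/

namespace PolyTime

open Prec Function

/-- The four stacks: input is read from `A`, output is written to `B`. -/
inductive Stk
  | M | A | B | C
  deriving DecidableEq

instance : Fintype Stk := ⟨{.M, .A, .B, .C}, fun k => by cases k <;> decide⟩

/-- Contents of all stacks. -/
abbrev Store := Stk → List Symbol

/-- Structured programs on the stacks. -/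
inductive Prog
  | push (k : Stk) (a : Symbol)
  | pop (k : Stk)
  | copyTop (k k' : Stk)
  | seq (p q : Prog)
  | ite (k : Stk) (c : Option Symbol → Bool) (p q : Prog)
  | loop (k : Stk) (c : Option Symbol → Bool) (p : Prog)

namespace Prog

/-- `Run p S S' t`: started with the stacks `S`, the program `p` ends with the stacks `S'` after at
most `t` steps. -/
inductive Run : Prog → Store → Store → ℕ → Prop
  | push (k a S) : Run (push k a) S (update S k (a :: S k)) 1
  | pop (k S) : Run (pop k) S (update S k (S k).tail) 1
  | copyTop (k k' S) :
      Run (copyTop k k') S (update S k' ((S k).head?.getD Symbol.slash :: S k')) 1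
  | seq {p q S S' S'' t t'} (h : Run p S S' t) (h' : Run q S' S'' t') :
      Run (seq p q) S S'' (t + t')
  | iteTrue {k c p q S S' t} (hc : c (S k).head? = true) (h : Run p S S' t) :
      Run (ite k c p q) S S' (t + 1)
  | iteFalse {k c p q S S' t} (hc : c (S k).head? = false) (h : Run q S S' t) :
      Run (ite k c p q) S S' (t + 1)
  | loopFalse {k c p S} (hc : c (S k).head? = false) : Run (loop k c p) S S 1
  | loopTrue {k c p S S' S'' t t'} (hc : c (S k).head? = true) (h : Run p S S' t)
      (h' : Run (loop k c p) S' S'' t') : Run (loop k c p) S S'' (t + t' + 1)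
  | weaken {p S S' t t'} (h : Run p S S' t) (ht : t ≤ t') : Run p S S' t'

/-- One step pushes at most one symbol. Running time therefore bounds output size, which is what
makes polynomial time closed under composition. -/
theorem Run.length_le {p S S' t} (h : Run p S S' t) (k : Stk) :
    (S' k).length ≤ (S k).length + t := by
  induction h with
  | push k' a S | copyTop k₁ k' S =>
    by_cases hk : k = k'
    · subst hk; simp
    · simp [update_of_ne hk]
  | pop k' S =>
    by_cases hk : k = k'
    · subst hk; simp; omega
    · simp [update_of_ne hk]
  | _ => omega

/-- Labels of the machine that executes a program. -/
def Label : Prog → Type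
  | push _ _ | pop _ | copyTop _ _ => Unit
  | seq p q => Label p ⊕ Label q
  | ite _ _ p q => Option (Label p ⊕ Label q)
  | loop _ _ p => Option (Label p)

/-- The label at which the execution of a program starts. -/
def start : (p : Prog) → Label p
  | push _ _ | pop _ | copyTop _ _ => ()
  | seq p _ => Sum.inl (start p)
  | ite _ _ _ _ | loop _ _ _ => none

instance fintypeLabel : (p : Prog) → Fintype (Label p)
  | push _ _ | pop _ | copyTop _ _ => inferInstanceAs (Fintype Unit)
  | seq p q =>
    letI := fintypeLabel p
    letI := fintypeLabel q
    inferInstanceAs (Fintype (Label p ⊕ Label q))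
  | ite _ _ p q =>
    letI := fintypeLabel p
    letI := fintypeLabel q
    inferInstanceAs (Fintype (Option (Label p ⊕ Label q)))
  | loop _ _ p =>
    letI := fintypeLabel p
    inferInstanceAs (Fintype (Option (Label p)))

/-- Statements of the stack machines; the internal state holds a symbol temporarily. -/
abbrev Code (Λ : Type) := Turing.TM2.Stmt (fun _ : Stk => Symbol) Λ (Option Symbol)

/-- Reset the internal state and jump, or halt if there is no target. -/
def jump {Λ : Type} : Option Λ → Code Λ
  | some l => .load (fun _ => none) (.goto fun _ => l)
  | none => .load (fun _ => none) .halt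

/-- The statements that execute a program whose labels are embedded by `e`, and which is left to
the label `x`. -/
def code {Λ : Type} : (p : Prog) → (Label p → Λ) → Option Λ → Label p → Code Λ
  | push k a, _, x, _ => .push k (fun _ => a) (jump x)
  | pop k, _, x, _ => .pop k (fun v _ => v) (jump x)
  | copyTop k k', _, x, _ =>
    .peek k (fun _ a => a) (.push k' (fun v => v.getD Symbol.slash) (jump x))
  | seq p q, e, x, l =>
    match l with
    | Sum.inl l => code p (fun l => e (Sum.inl l)) (some (e (Sum.inr q.start))) l
    | Sum.inr l => code q (fun l => e (Sum.inr l)) x l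
  | ite k c p q, e, x, l =>
    match l with
    | none => .peek k (fun _ a => a) (.branch c (jump (some (e (some (Sum.inl p.start)))))
        (jump (some (e (some (Sum.inr q.start))))))
    | some (Sum.inl l) => code p (fun l => e (some (Sum.inl l))) x l
    | some (Sum.inr l) => code q (fun l => e (some (Sum.inr l))) x l
  | loop k c p, e, x, l =>
    match l with
    | none => .peek k (fun _ a => a) (.branch c (jump (some (e (some p.start)))) (jump x))
    | some l => code p (fun l => e (some l)) (some (e none)) l

/-- Configurations of the stack machines. -/
abbrev Conf (Λ : Type) := Turing.TM2.Cfg (fun _ : Stk => Symbol) Λ (Option Symbol)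

/-- Reachability in at most `t` steps. -/
def Reaches {Λ : Type} (m : Λ → Code Λ) (c c' : Conf Λ) (t : ℕ) : Prop :=
  ∃ n ≤ t, (flip bind (Turing.TM2.step m))^[n] (some c) = some c'

theorem Reaches.trans {Λ : Type} {m : Λ → Code Λ} {c c' c'' : Conf Λ} {t t' : ℕ}
    (h : Reaches m c c' t) (h' : Reaches m c' c'' t') : Reaches m c c'' (t + t') := by
  obtain ⟨n, hn, h⟩ := h
  obtain ⟨n', hn', h'⟩ := h'
  exact ⟨n' + n, by omega, by rw [iterate_add_apply, h, h']⟩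

theorem Reaches.single {Λ : Type} {m : Λ → Code Λ} {c c' : Conf Λ}
    (h : Turing.TM2.step m c = some c') : Reaches m c c' 1 :=
  ⟨1, le_rfl, h⟩

theorem stepAux_jump {Λ : Type} (x : Option Λ) (v : Option Symbol) (S : Store) :
    Turing.TM2.stepAux (jump x) v S = ⟨x, none, S⟩ := by
  cases x <;> rfl

/-- The embedding `e` and the exit `x` are arbitrary because a subprogram occupies only some labels
of a larger machine and leaves to whatever follows it. As `jump` resets the internal state, every
piece starts and ends with `none`. -/
theorem Run.reaches {p S S' t} (h : Run p S S' t) {Λ : Type} (m : Λ → Code Λ)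
    (e : Label p → Λ) (x : Option Λ) (hm : ∀ l, m (e l) = code p e x l) :
    Reaches m ⟨some (e p.start), none, S⟩ ⟨x, none, S'⟩ t := by
  induction h generalizing x with
  | push k a S | pop k S | copyTop k k' S =>
    refine Reaches.single ?_
    rw [Turing.TM2.step, hm]
    simp [code, stepAux_jump]
  | @seq p q S S' S'' t t' _ _ ih ih' =>
    exact (ih (fun l => e (Sum.inl l)) (some (e (Sum.inr q.start))) fun l => hm (Sum.inl l)).trans
      (ih' (fun l => e (Sum.inr l)) x fun l => hm (Sum.inr l))
  | @iteTrue k c p q S S' t hc _ ih =>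
    rw [add_comm]
    refine (Reaches.single ?_).trans
      (ih (fun l => e (some (Sum.inl l))) x fun l => hm (some (Sum.inl l)))
    rw [Turing.TM2.step, hm]
    simp [code, start, stepAux_jump, hc]
  | @iteFalse k c p q S S' t hc _ ih =>
    rw [add_comm]
    refine (Reaches.single ?_).trans
      (ih (fun l => e (some (Sum.inr l))) x fun l => hm (some (Sum.inr l)))
    rw [Turing.TM2.step, hm]
    simp [code, start, stepAux_jump, hc]
  | @loopFalse k c p S hc =>
    refine Reaches.single ?_
    rw [Turing.TM2.step, hm]
    simp [code, start, stepAux_jump, hc]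
  | @loopTrue k c p S S' S'' t t' hc _ _ ih ih' =>
    rw [add_comm]
    refine (Reaches.single ?_).trans
      ((ih (fun l => e (some l)) (some (e none)) fun l => hm (some l)).trans (ih' e x hm))
    rw [Turing.TM2.step, hm]
    simp [code, start, stepAux_jump, hc]
  | weaken _ ht ih =>
    obtain ⟨n, hn, h⟩ := ih e x hm
    exact ⟨n, hn.trans ht, h⟩

/-- The machine that executes a program. -/
def machine (p : Prog) : Turing.FinTM2 where
  K := Stk
  k₀ := .A
  k₁ := .B
  Γ _ := Symbol
  Λ := Label p
  main := p.start
  ΛFin := fintypeLabel p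
  σ := Option Symbol
  initialState := none
  Γk₀Fin := inferInstanceAs (Fintype Symbol)
  m := code p id none

/-- The stacks with given contents. -/
def st (m a b c : List Symbol) : Store
  | .M => m
  | .A => a
  | .B => b
  | .C => c

/-- The machine model prescribes the complete halting configuration, so the program has to empty
every stack other than the output stack `B`. -/
theorem computable_of_run {I O : Type} {ei : I → List Symbol} {eo : O → List Symbol} {f : I → O}
    (p : Prog) (P : Polynomial ℕ)
    (h : ∀ x, Run p (st [] (ei x) [] []) (st [] [] (eo (f x)) []) (P.eval (ei x).length)) :
    Nonempty (Turing.TM2ComputableInPolyTime ei eo f) := by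
  refine ⟨⟨⟨p.machine, Equiv.refl _, Equiv.refl _⟩, P, fun x => ?_⟩⟩
  have hr := (h x).reaches (code p id none) id none fun _ => rfl
  refine ⟨⟨hr.choose, ?_⟩, hr.choose_spec.1⟩
  have h₁ : Turing.initList p.machine (List.map (Equiv.refl Symbol).invFun (ei x)) =
      (⟨some p.start, none, st [] (ei x) [] []⟩ : Conf (Label p)) := by
    unfold Turing.initList
    congr 1
    funext k
    cases k <;> first | rfl | exact List.map_id _
  have h₂ : Turing.haltList p.machine (List.map (Equiv.refl Symbol).invFun (eo (f x))) =
      (⟨none, none, st [] [] (eo (f x)) []⟩ : Conf (Label p)) := by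
    unfold Turing.haltList
    congr 1
    funext k
    cases k <;> first | rfl | exact List.map_id _
  refine Eq.trans ?_ (hr.choose_spec.2.trans ?_)
  · exact congrArg _ (congrArg some h₁)
  · exact (congrArg some h₂).symm

end Prog

end PolyTime

/-! ### Polynomial-time functions on coded data -/

namespace PolyTime

open Prec Function

/-- Binary trees with Boolean leaves, the universal data type. -/
inductive Data
  | leaf (b : Bool)
  | node (x y : Data)

namespace Data

/-- The preorder string of a tree. -/
def str : Data → List Symbol
  | leaf b => [.bit b]
  | node x y => .comma :: (x.str ++ y.str)

/-- The left subtree. -/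
def left : Data → Data
  | leaf b => leaf b
  | node x _ => x

/-- The right subtree. -/
def right : Data → Data
  | leaf b => leaf b
  | node _ y => y

/-- Whether a tree is not a leaf. -/
def isNode : Data → Bool
  | leaf _ => false
  | node _ _ => true

end Data

/-- Types whose elements are represented by trees. -/
class Coded (α : Type) where
  /-- the tree that represents an element -/
  enc : α → Data

open Coded

instance : Coded Data := ⟨id⟩

instance : Coded Bool := ⟨Data.leaf⟩

instance {α β : Type} [Coded α] [Coded β] : Coded (α × β) :=
  ⟨fun p => .node (enc p.1) (enc p.2)⟩

/-- Lists are represented by right combs. -/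
def encList {α : Type} [Coded α] : List α → Data
  | [] => .leaf false
  | a :: l => .node (enc a) (encList l)

instance {α : Type} [Coded α] : Coded (List α) := ⟨encList⟩

section

variable {α β γ δ : Type} [Coded α] [Coded β] [Coded γ] [Coded δ]

/-- The string that represents an element. -/
def str (a : α) : List Symbol := (enc a).str

/-- The length of the string that represents an element. -/
def sz (a : α) : ℕ := (str a).length

theorem str_bool (b : Bool) : str b = [.bit b] := rfl

theorem str_prod (a : α) (b : β) : str (a, b) = .comma :: (str a ++ str b) := rfl

@[simp] theorem sz_bool (b : Bool) : sz b = 1 := rfl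

@[simp] theorem sz_prod (p : α × β) : sz p = sz p.1 + sz p.2 + 1 := by
  simp [sz, str, enc, Data.str]

@[simp] theorem sz_nil : sz ([] : List α) = 1 := rfl

@[simp] theorem sz_cons (a : α) (l : List α) : sz (a :: l) = sz a + sz l + 1 := by
  simp [sz, str, enc, encList, Data.str]

theorem length_lt_sz (l : List α) : l.length < sz l := by
  induction l with
  | nil => simp
  | cons s l ih => simp; omega

theorem sz_pos (a : α) : 0 < sz a := by
  unfold sz str
  cases enc a <;> simp [Data.str]

/-! #### Basic programs -/

namespace Prog

@[simp] theorem update_st_M (m a b c x) : update (st m a b c) .M x = st x a b c := by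
  funext k; cases k <;> rfl

@[simp] theorem update_st_A (m a b c x) : update (st m a b c) .A x = st m x b c := by
  funext k; cases k <;> rfl

@[simp] theorem update_st_B (m a b c x) : update (st m a b c) .B x = st m a x c := by
  funext k; cases k <;> rfl

@[simp] theorem update_st_C (m a b c x) : update (st m a b c) .C x = st m a b x := by
  funext k; cases k <;> rfl

theorem Run.of_eq {p S S' S'' t t'} (h : Run p S S' t) (hS : S' = S'') (ht : t ≤ t') :
    Run p S S'' t' := hS ▸ h.weaken ht

theorem run_pushM (s m a b c) : Run (push .M s) (st m a b c) (st (s :: m) a b c) 1 :=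
  (Run.push _ _ _).of_eq (by simp [st]) le_rfl

theorem run_popM (s m a b c) : Run (pop .M) (st (s :: m) a b c) (st m a b c) 1 :=
  (Run.pop _ _).of_eq (by simp [st]) le_rfl

/-- Move everything from the stack `k` to the stack `k'`. -/
def transfer (k k' : Stk) : Prog := loop k Option.isSome (seq (copyTop k k') (pop k))

theorem run_transfer {k k' : Stk} (hk : k ≠ k') (l : List Symbol) (S : Store) (hS : S k = l) :
    Run (transfer k k') S (update (update S k' (l.reverse ++ S k')) k []) (3 * l.length + 1) := by
  induction l generalizing S with
  | nil =>
    refine (Run.loopFalse (by simp [hS])).of_eq ?_ (by simp)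
    funext j
    by_cases h : j = k
    · subst h; simp [hS]
    · simp [h]
  | cons s l ih =>
    refine (Run.loopTrue (by simp [hS]) ((Run.copyTop k k' S).seq (Run.pop k _))
      (ih _ (by simp [hS, hk]))).of_eq ?_ (by simp; omega)
    funext j
    by_cases h₁ : j = k
    · subst h₁; simp
    · by_cases h₂ : j = k'
      · subst h₂; simp [hS, hk.symm]
      · simp [h₁, h₂]

theorem run_transferAM (m a b c) :
    Run (transfer .A .M) (st m a b c) (st (a.reverse ++ m) [] b c) (3 * a.length + 1) :=
  (run_transfer (by decide) a _ rfl).of_eq (by simp [st]) le_rfl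

theorem run_transferAB (m a b c) :
    Run (transfer .A .B) (st m a b c) (st m [] (a.reverse ++ b) c) (3 * a.length + 1) :=
  (run_transfer (by decide) a _ rfl).of_eq (by simp [st]) le_rfl

theorem run_transferBA (m a b c) :
    Run (transfer .B .A) (st m a b c) (st m (b.reverse ++ a) [] c) (3 * b.length + 1) :=
  (run_transfer (by decide) b _ rfl).of_eq (by simp [st]) le_rfl

/-- Scan symbols from `M` to `A` until the counter `C`, the number of open subtrees, is zero. -/
def scan : Prog :=
  loop .C Option.isSome
    (seq (ite .M (fun s => s = some .comma) (push .C .comma) (pop .C))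
      (seq (copyTop .M .A) (pop .M)))

/-- Preorder strings are self-delimiting: a leaf closes one open subtree, and an inner node replaces
one by two. The rest of the loop enters as a continuation, so that the two subtrees of a node can be
chained inside a single loop. -/
theorem run_scan (d : Data) (m a b c : List Symbol) (s : Symbol) (S : Store) (t : ℕ)
    (h : Run scan (st m (d.str.reverse ++ a) b c) S t) :
    Run scan (st (d.str ++ m) a b (s :: c)) S (t + 5 * d.str.length) := by
  induction d generalizing m a c s t with
  | leaf x =>
    refine (Run.loopTrue rfl ((Run.iteFalse ?_ (Run.pop _ _)).seq
      ((Run.copyTop _ _ _).seq (Run.pop _ _))) (S'' := S) (t' := t) ?_).weaken ?_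
    · simp [st, Data.str]
    · simpa [st, Data.str, scan] using h
    · simp [Data.str]; omega
  | node x y ihx ihy =>
    refine (Run.loopTrue rfl ((Run.iteTrue ?_ (Run.push _ _ _)).seq
      ((Run.copyTop _ _ _).seq (Run.pop _ _))) (S'' := S)
        (t' := t + 5 * y.str.length + 5 * x.str.length) ?_).weaken ?_
    · simp [st, Data.str]
    -- The scan of `y` is the continuation of the scan of `x`; the `comma` just pushed on the
    -- counter is consumed by `x`, and `s` by `y`.
    · have := ihx (y.str ++ m) (.comma :: a) (s :: c) .comma _ (ihy m _ c s t (by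
        simpa [Data.str] using h))
      simpa [st, Data.str, scan] using this
    · simp [Data.str]; omega

/-- Move a tree from `M` to `A`. -/
def take : Prog := seq (push .C .comma) scan

theorem run_take (d : Data) (m a b : List Symbol) :
    Run take (st (d.str ++ m) a b []) (st m (d.str.reverse ++ a) b []) (5 * d.str.length + 2) := by
  refine ((Run.push _ _ _).seq (t' := 1 + 5 * d.str.length) (S'' := _) ?_).of_eq rfl (by omega)
  simpa [st] using run_scan d m a b [] .comma _ 1 (Run.loopFalse (by simp [st]))

/-- Remove everything from the stack `A`. -/
def clearA : Prog := loop .A Option.isSome (pop .A)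

theorem run_clearA (m a b c) : Run clearA (st m a b c) (st m [] b c) (2 * a.length + 1) := by
  induction a with
  | nil => exact Run.loopFalse (by simp [st])
  | cons s a ih =>
    exact (Run.loopTrue (by simp [st]) (Run.pop _ _) (by simpa [st, clearA] using ih)).weaken
      (by simp; omega)

/-- Remove a tree from `M`. -/
def drop : Prog := seq take clearA

theorem run_drop (d : Data) (m b : List Symbol) :
    Run drop (st (d.str ++ m) [] b []) (st m [] b []) (7 * d.str.length + 3) :=
  ((run_take _ _ _ _).seq (run_clearA _ _ _ _)).weaken (by simp; omega)

/-- Exchange the two topmost trees of `M`. -/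
def swap : Prog :=
  seq take (seq (transfer .A .B) (seq take (seq (transfer .B .A) (transfer .A .M))))

/-- Each move reverses a string. The first tree moves four times and the second twice, so both
arrive the right way round, in exchanged order. -/
theorem run_swap (d e : Data) (m : List Symbol) :
    Run swap (st (d.str ++ (e.str ++ m)) [] [] []) (st (e.str ++ (d.str ++ m)) [] [] [])
      (14 * (d.str.length + e.str.length) + 8) :=
  ((run_take _ _ _ _).seq ((run_transferAB _ _ _ _).seq ((run_take _ _ _ _).seq
    ((run_transferBA _ _ _ _).seq (run_transferAM _ _ _ _))))).of_eq (by simp) (by simp; omega)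

/-- Move everything from `A` to `M`, and a copy to `B`. -/
def spread : Prog :=
  loop .A Option.isSome (seq (copyTop .A .B) (seq (copyTop .A .M) (pop .A)))

theorem run_spread (m a b c) :
    Run spread (st m a b c) (st (a.reverse ++ m) [] (a.reverse ++ b) c) (4 * a.length + 1) := by
  induction a generalizing m b with
  | nil => exact Run.loopFalse (by simp [st])
  | cons s a ih =>
    exact (Run.loopTrue (by simp [st]) ((Run.copyTop _ _ _).seq ((Run.copyTop _ _ _).seq
      (Run.pop _ _))) (by simpa [st, spread] using ih (s :: m) (s :: b))).of_eq (by simp)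
      (by simp; omega)

/-- Duplicate the topmost tree of `M`. -/
def dup : Prog := seq take (seq spread (seq (transfer .B .A) (transfer .A .M)))

theorem run_dup (d : Data) (m : List Symbol) :
    Run dup (st (d.str ++ m) [] [] []) (st (d.str ++ (d.str ++ m)) [] [] [])
      (15 * d.str.length + 5) :=
  ((run_take _ _ _ _).seq ((run_spread _ _ _ _).seq ((run_transferBA _ _ _ _).seq
    (run_transferAM _ _ _ _)))).of_eq (by simp) (by simp; omega)

/-- Push a string onto `M`, followed by a program. -/
def pushStr : List Symbol → Prog → Prog
  | [], p => p
  | s :: l, p => pushStr l (seq (push .M s) p)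

/-- The program to be run afterwards is an argument because the language has no empty program to
serve for the empty string. -/
theorem run_pushStr (l m a b c : List Symbol) (p : Prog) (S : Store) (t : ℕ)
    (h : Run p (st (l ++ m) a b c) S t) :
    Run (pushStr l p) (st m a b c) S (t + l.length) := by
  induction l generalizing p t with
  | nil => exact h
  | cons s l ih =>
    exact (ih _ (1 + t) ((run_pushM _ _ _ _ _).seq h)).weaken (by simp; omega)

end Prog

open Prog

/-! #### Polynomial bounds -/

theorem eval_mono (P : Polynomial ℕ) {m n : ℕ} (h : m ≤ n) : P.eval m ≤ P.eval n := by
  rw [Polynomial.eval_eq_sum_range, Polynomial.eval_eq_sum_range]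
  gcongr

/-- Quantities that are polynomially bounded in the size of their argument. -/
def PB (t : α → ℕ) : Prop := ∃ P : Polynomial ℕ, ∀ a, t a ≤ P.eval (sz a)

namespace PB

theorem mono {s t : α → ℕ} (h : PB t) (hst : ∀ a, s a ≤ t a) : PB s :=
  h.imp fun _ hP a => (hst a).trans (hP a)

theorem const (k : ℕ) : PB fun _ : α => k := ⟨.C k, fun _ => by simp⟩

theorem size : PB fun a : α => sz a := ⟨.X, fun _ => by simp⟩

theorem add {s t : α → ℕ} (hs : PB s) (ht : PB t) : PB fun a => s a + t a := by
  obtain ⟨P, hP⟩ := hs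
  obtain ⟨Q, hQ⟩ := ht
  exact ⟨P + Q, fun a => by simpa using add_le_add (hP a) (hQ a)⟩

theorem mul {s t : α → ℕ} (hs : PB s) (ht : PB t) : PB fun a => s a * t a := by
  obtain ⟨P, hP⟩ := hs
  obtain ⟨Q, hQ⟩ := ht
  exact ⟨P * Q, fun a => by simpa using Nat.mul_le_mul (hP a) (hQ a)⟩

theorem eval {t : α → ℕ} (ht : PB t) (P : Polynomial ℕ) : PB fun a => P.eval (t a) := by
  obtain ⟨Q, hQ⟩ := ht
  exact ⟨P.comp Q, fun a => by simpa [Polynomial.eval_comp] using eval_mono P (hQ a)⟩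

end PB

/-- Functions that some program computes in polynomial time on top of the stack `M`. -/
@[fun_prop]
def PT (f : α → β) : Prop :=
  ∃ p : Prog, ∃ P : Polynomial ℕ, ∀ a m,
    Run p (st (str a ++ m) [] [] []) (st (str (f a) ++ m) [] [] []) (P.eval (sz a))

theorem PT.of_run {f : α → β} {t : α → ℕ} (p : Prog) (ht : PB t)
    (h : ∀ a m, Run p (st (str a ++ m) [] [] []) (st (str (f a) ++ m) [] [] []) (t a)) : PT f := by
  obtain ⟨P, hP⟩ := ht
  exact ⟨p, P, fun a m => (h a m).weaken (hP a)⟩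

theorem PT.size {f : α → β} (hf : PT f) : PB fun a => sz (f a) := by
  obtain ⟨p, P, h⟩ := hf
  refine PB.mono (PB.size.add ⟨P, fun a => le_rfl⟩) fun a => ?_
  simpa [st, sz] using (h a []).length_le .M

theorem PB.comp {t : β → ℕ} (ht : PB t) {f : α → β} (hf : PT f) : PB fun a => t (f a) := by
  obtain ⟨P, hP⟩ := ht
  exact (hf.size.eval P).mono fun a => hP _

namespace PT

theorem of_enc {f : α → β} (h : PT fun a => enc (f a)) : PT f := h

/-- A mere change of type needs a program that does nothing; a push undone by a pop serves as one.
-/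
theorem of_enc_eq {f : α → β} (h : ∀ a, enc (f a) = enc a) : PT f := by
  refine of_run (seq (push .M .slash) (pop .M)) (PB.const 2) fun a m => ?_
  have : str (f a) = str a := by simp [str, h]
  rw [this]
  exact (run_pushM _ _ _ _ _).seq (run_popM _ _ _ _ _)

@[fun_prop]
theorem id : PT fun a : α => a := of_enc_eq fun _ => rfl

@[fun_prop]
theorem comp {g : β → γ} (hg : PT g) {f : α → β} (hf : PT f) : PT fun a => g (f a) := by
  have hsz := hf.size
  obtain ⟨p, P, hp⟩ := hf
  obtain ⟨q, Q, hq⟩ := hg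
  exact of_run (seq p q) (PB.add ⟨P, fun a => le_rfl⟩ (hsz.eval Q))
    fun a m => (hp a m).seq (hq _ m)

@[fun_prop]
theorem const (b : β) : PT fun _ : α => b := by
  refine of_run (seq drop (pushStr (str b) (seq (push .M .slash) (pop .M))))
    ((((PB.const 7).mul PB.size).add (PB.const 3)).add (PB.const (2 + (str b).length)))
    fun a m => ?_
  exact (run_drop (enc a) m []).seq (run_pushStr _ m [] [] [] _ _ 2
    ((run_pushM _ _ _ _ _).seq (run_popM _ _ _ _ _)))

@[fun_prop]
theorem prodMk {f : α → β} {g : α → γ} (hf : PT f) (hg : PT g) : PT fun a => (f a, g a) := by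
  have hsz := hg.size
  obtain ⟨p, P, hp⟩ := hf
  obtain ⟨q, Q, hq⟩ := hg
  -- The second component is computed first: after the swap the first one is computed above it,
  -- where the preorder string expects it.
  refine of_run (t := fun a => (15 * sz a + 5) + (Q.eval (sz a) +
    ((14 * (sz (g a) + sz a) + 8) + (P.eval (sz a) + 1))))
    (seq dup (seq q (seq swap (seq p (push .M .comma))))) ?_ fun a m => ?_
  · exact ((((PB.const 15).mul PB.size).add (PB.const 5)).add (PB.add ⟨Q, fun a => le_rfl⟩
      ((((PB.const 14).mul (hsz.add PB.size)).add (PB.const 8)).add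
        (PB.add ⟨P, fun a => le_rfl⟩ (PB.const 1)))))
  · exact ((run_dup (enc a) m).seq ((hq a _).seq ((run_swap (enc (g a)) (enc a) m).seq
      ((hp a _).seq (run_pushM _ _ _ _ _))))).of_eq (by simp [str_prod]; rfl) le_rfl

@[fun_prop]
theorem fst' : PT fun p : α × β => p.1 := by
  refine of_run (t := fun p => 1 + ((14 * (sz p.1 + sz p.2) + 8) + (7 * sz p.2 + 3)))
    (seq (pop .M) (seq swap drop)) ?_ fun p m => ?_
  · exact (((PB.const 21).mul PB.size).add (PB.const 12)).mono fun a => by simp; omega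
  · refine Run.seq ?_ ((run_swap (enc p.1) (enc p.2) m).seq (run_drop (enc p.2) _ []))
    simpa [str, enc, Data.str] using run_popM .comma (str p.1 ++ (str p.2 ++ m)) [] [] []

@[fun_prop]
theorem snd' : PT fun p : α × β => p.2 := by
  refine of_run (t := fun p => 1 + (7 * sz p.1 + 3)) (seq (pop .M) drop) ?_ fun p m => ?_
  · exact (((PB.const 7).mul PB.size).add (PB.const 12)).mono fun a => by simp; omega
  · refine Run.seq ?_ (run_drop (enc p.1) _ [])
    simpa [str, enc, Data.str] using run_popM .comma (str p.1 ++ (str p.2 ++ m)) [] [] []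

@[fun_prop]
theorem fst {f : α → β × γ} (hf : PT f) : PT fun a => (f a).1 := fst'.comp hf

@[fun_prop]
theorem snd {f : α → β × γ} (hf : PT f) : PT fun a => (f a).2 := snd'.comp hf

@[fun_prop]
theorem cond {c : α → Bool} {f g : α → β} (hc : PT c) (hf : PT f) (hg : PT g) :
    PT fun a => cond (c a) (f a) (g a) := by
  obtain ⟨p, P, hp⟩ := hf
  obtain ⟨q, Q, hq⟩ := hg
  obtain ⟨r, R, hr⟩ := hc
  refine of_run (t := fun a => (15 * sz a + 5) + (R.eval (sz a) +
    ((1 + (P.eval (sz a) + Q.eval (sz a))) + 1)))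
    (seq dup (seq r (ite .M (fun s => s = some (.bit true)) (seq (pop .M) p) (seq (pop .M) q))))
    ?_ fun a m => ?_
  · exact (((PB.const 15).mul PB.size).add (PB.const 5)).add (PB.add ⟨R, fun a => le_rfl⟩
      (((PB.const 1).add (PB.add ⟨P, fun a => le_rfl⟩ ⟨Q, fun a => le_rfl⟩)).add (PB.const 1)))
  · refine (run_dup (enc a) m).seq ((hr a _).seq ?_)
    cases h : c a
    · exact Run.iteFalse (by simp [st, str_bool]) ((run_popM _ _ _ _ _).seq
        ((hq a m).weaken (by omega)))
    · exact Run.iteTrue (by simp [st, str_bool]) ((run_popM _ _ _ _ _).seq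
        ((hp a m).weaken (by omega)))

theorem isNode : PT Data.isNode := by
  refine of_run (t := fun d => 7 * sz d + 3 + 1 + 1)
    (ite .M (fun s => s = some .comma) (seq drop (push .M (.bit true)))
      (seq drop (push .M (.bit false)))) ?_ fun d m => ?_
  · exact ((((PB.const 7).mul PB.size).add (PB.const 3)).add (PB.const 1)).add (PB.const 1)
  · cases d with
    | leaf b =>
      exact Run.iteFalse (by simp [st, str, enc, Data.str]) ((run_drop _ m []).seq
        (run_pushM _ _ _ _ _))
    | node x y =>
      exact Run.iteTrue (by simp [st, str, enc, Data.str]) ((run_drop _ m []).seq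
        (run_pushM _ _ _ _ _))

theorem left : PT Data.left := by
  refine of_run (t := fun d => 30 * sz d + 30)
    (ite .M (fun s => s = some .comma) (seq (pop .M) (seq swap drop))
      (seq (push .M (.bit true)) (pop .M))) ?_ fun d m => ?_
  · exact ((PB.const 30).mul PB.size).add (PB.const 30)
  · cases d with
    | leaf b =>
      exact (Run.iteFalse (by simp [st, str, enc, Data.str]) ((run_pushM _ _ _ _ _).seq
        (run_popM _ _ _ _ _))).weaken (by omega)
    | node x y =>
      refine (Run.iteTrue (by simp [st, str, enc, Data.str]) (Run.seq ?_
        ((run_swap x y m).seq (run_drop y _ [])))).weaken (t := 1 + _ + 1) ?_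
      · simpa [str, enc, Data.str] using run_popM .comma (x.str ++ (y.str ++ m)) [] [] []
      · simp [sz, str, enc, Data.str]; omega

theorem right : PT Data.right := by
  refine of_run (t := fun d => 7 * sz d + 5)
    (ite .M (fun s => s = some .comma) (seq (pop .M) drop)
      (seq (push .M (.bit true)) (pop .M))) ?_ fun d m => ?_
  · exact ((PB.const 7).mul PB.size).add (PB.const 5)
  · cases d with
    | leaf b =>
      exact (Run.iteFalse (by simp [st, str, enc, Data.str]) ((run_pushM _ _ _ _ _).seq
        (run_popM _ _ _ _ _))).weaken (by omega)
    | node x y =>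
      refine (Run.iteTrue (by simp [st, str, enc, Data.str]) (Run.seq ?_
        (run_drop x (y.str ++ m) []))).weaken (t := 1 + _ + 1) ?_
      · simpa [str, enc, Data.str] using run_popM .comma (x.str ++ (y.str ++ m)) [] [] []
      · simp [sz, str, enc, Data.str]; omega

/-- Bounded iteration. -/
theorem iterate {s : α → β} {c : β → Bool} {f : β → β} (hs : PT s) (hc : PT c) (hf : PT f)
    {N B : α → ℕ} (hB : PB B) (hN : ∀ a, N a ≤ B a)
    (htrue : ∀ a, ∀ i < N a, c (f^[i] (s a)) = true) (hfalse : ∀ a, c (f^[N a] (s a)) = false)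
    (hsz : ∀ a, ∀ i ≤ N a, sz (f^[i] (s a)) ≤ B a) : PT fun a => f^[N a] (s a) := by
  obtain ⟨p, P, hp⟩ := hs
  obtain ⟨q, Q, hq⟩ := hf
  obtain ⟨r, R, hr⟩ := hc
  -- Here `k` counts the iterations still to come. Before each test the stack holds the flag of the
  -- current iterate, with the iterate itself below. The cost per round is uniform since all
  -- iterates have size at most `B a`.
  have hloop : ∀ a m k, k ≤ N a →
      Run (loop .M (fun s => s = some (.bit true)) (seq (pop .M) (seq q (seq dup r))))
        (st (str (c (f^[N a - k] (s a))) ++ (str (f^[N a - k] (s a)) ++ m)) [] [] [])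
        (st (str (c (f^[N a] (s a))) ++ (str (f^[N a] (s a)) ++ m)) [] [] [])
        (k * (Q.eval (B a) + (15 * B a + 7) + R.eval (B a)) + 1) := by
    intro a m k hk
    induction k with
    | zero =>
      refine (Run.loopFalse ?_).weaken (by omega)
      simp [st, str_bool, hfalse]
    | succ k ih =>
      have e₁ : N a - k = N a - (k + 1) + 1 := by omega
      have h₁ := hsz a (N a - (k + 1)) (by omega)
      have h₂ := hsz a (N a - k) (by omega)
      have ih := ih (by omega)
      set b := f^[N a - (k + 1)] (s a) with hb
      have e₂ : f^[N a - k] (s a) = f b := by rw [hb, e₁, iterate_succ_apply']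
      rw [e₂] at ih h₂
      have hcb : c b = true := htrue a _ (by omega)
      refine (Run.loopTrue (by rw [hcb]; rfl) ((run_popM _ _ _ _ _).seq ((hq b m).seq
        ((run_dup (enc (f b)) m).seq (hr (f b) _)))) ih).weaken ?_
      have h₃ := eval_mono Q h₁
      have h₄ := eval_mono R h₂
      have h₅ : (enc (f b)).str.length ≤ B a := h₂
      rw [add_mul, one_mul]
      omega
  refine of_run (t := fun a => P.eval (sz a) + ((15 * B a + 5) + (R.eval (B a) +
    ((B a * (Q.eval (B a) + (15 * B a + 7) + R.eval (B a)) + 1) + 1))))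
    (seq p (seq dup (seq r (seq (loop .M (fun s => s = some (.bit true))
      (seq (pop .M) (seq q (seq dup r)))) (pop .M))))) ?_ fun a m => ?_
  · have h₁ := ((PB.const 15).mul hB).add (PB.const 5)
    have h₂ := hB.eval R
    exact PB.add ⟨P, fun a => le_rfl⟩ (h₁.add (h₂.add (((hB.mul (((hB.eval Q).add
      (((PB.const 15).mul hB).add (PB.const 7))).add h₂)).add (PB.const 1)).add (PB.const 1))))
  · have h₀ : sz (s a) ≤ B a := hsz a 0 (Nat.zero_le _)
    have hl := hloop a m (N a) le_rfl
    rw [Nat.sub_self] at hl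
    refine (hp a m).seq (((run_dup (enc (s a)) m).weaken ?_).seq (((hr _ _).weaken ?_).seq
      ((hl.weaken ?_).seq (run_popM _ _ _ _ _))))
    · have : (enc (s a)).str.length ≤ B a := h₀
      omega
    · exact eval_mono R h₀
    · gcongr
      exact hN a

end PT

end

end PolyTime

namespace PolyTime

open Prec Function Coded Prog

/-! ### Input and output -/

/-- Symbols are represented by small trees. -/
def encSymbol : Symbol → Data
  | .bit b => .leaf b
  | .slash => .node (.leaf false) (.leaf false)
  | .comma => .node (.leaf false) (.leaf true)
  | .semicolon => .node (.leaf true) (.leaf false)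

instance : Coded Symbol := ⟨encSymbol⟩

theorem sz_symbol_le (s : Symbol) : sz s ≤ 3 := by
  cases s <;> simp [sz, str, enc, encSymbol, Data.str]

/-- Coding the input string as a tree costs only a constant factor, so polynomial bounds in the
coded size are polynomial in the string length. -/
theorem sz_symbols_le (l : List Symbol) : sz l ≤ 4 * l.length + 1 := by
  induction l with
  | nil => simp
  | cons s l ih => simp; have := sz_symbol_le s; omega

/-- Move the topmost symbol of `B`, known to be `s`, to the list on top of `M`. -/
def loadSymbol (s : Symbol) : Prog := pushStr (.comma :: str s) (pop .B)

theorem run_loadSymbol (s : Symbol) (m b : List Symbol) :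
    Run (loadSymbol s) (st m [] (s :: b) []) (st (.comma :: (str s ++ m)) [] b []) 5 := by
  refine (run_pushStr _ _ _ _ _ _ _ 1 ?_).weaken (by
    have := sz_symbol_le s
    simp [sz] at this ⊢; omega)
  exact (Run.pop _ _).of_eq (by simp [st]) le_rfl

/-- Move the topmost symbol of `B` to the list on top of `M`. -/
def loadTop : Prog :=
  ite .B (fun s => s = some (.bit false)) (loadSymbol (.bit false))
    (ite .B (fun s => s = some (.bit true)) (loadSymbol (.bit true))
      (ite .B (fun s => s = some .slash) (loadSymbol .slash)
        (ite .B (fun s => s = some .comma) (loadSymbol .comma) (loadSymbol .semicolon))))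

theorem run_loadTop (s : Symbol) (m b : List Symbol) :
    Run loadTop (st m [] (s :: b) []) (st (.comma :: (str s ++ m)) [] b []) 9 := by
  have h := run_loadSymbol s m b
  rcases s with ⟨_ | _⟩ | _ | _ | _
  · exact (h.iteTrue (by simp [st])).weaken (by omega)
  · exact ((h.iteTrue (by simp [st])).iteFalse (by simp [st])).weaken (by omega)
  · exact (((h.iteTrue (by simp [st])).iteFalse (by simp [st])).iteFalse
      (by simp [st])).weaken (by omega)
  · exact (((h.iteTrue (by simp [st])).iteFalse (by simp [st])).iteFalse
      (by simp [st])).iteFalse (by simp [st])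
  · exact (((h.iteFalse (by simp [st])).iteFalse (by simp [st])).iteFalse
      (by simp [st])).iteFalse (by simp [st])

/-- Move all symbols of `B` to the list on top of `M`. -/
def loadAll : Prog := loop .B Option.isSome loadTop

theorem run_loadAll (l k : List Symbol) :
    Run loadAll (st (str k) [] l []) (st (str (l.reverse ++ k)) [] [] [])
      (10 * l.length + 1) := by
  induction l generalizing k with
  | nil => exact Run.loopFalse (by simp [st])
  | cons s l ih =>
    refine (Run.loopTrue (by simp [st]) (run_loadTop s _ l) (t' := 10 * l.length + 1)
      (S'' := _) ?_).weaken (by simp; omega)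
    simpa using! ih (s :: k)

/-- Read the input. -/
def load : Prog := seq (transfer .A .B) (seq (push .M (.bit false)) loadAll)

/-- The transfer reverses the input and the successive consing reverses it back; the initial `bit
false` codes the empty list. -/
theorem run_load (l : List Symbol) :
    Run load (st [] l [] []) (st (str l) [] [] []) (13 * l.length + 3) := by
  have h₁ := run_transferAB [] l [] []
  have h₂ := run_loadAll l.reverse []
  rw [List.append_nil] at h₁
  rw [List.append_nil, List.reverse_reverse] at h₂
  exact (h₁.seq ((run_pushM _ _ _ _ _).seq h₂)).weaken (by simp; omega)

/-- Move the symbol represented on top of `M` to `A`. -/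
def unloadTop : Prog :=
  ite .M (fun s => s = some .comma)
    (seq (pop .M) (ite .M (fun s => s = some (.bit false))
      (seq (pop .M) (ite .M (fun s => s = some (.bit false))
        (seq (pop .M) (push .A .slash)) (seq (pop .M) (push .A .comma))))
      (seq (pop .M) (seq (pop .M) (push .A .semicolon)))))
    (seq (copyTop .M .A) (pop .M))

theorem run_pushA (s m a b c) : Run (push .A s) (st m a b c) (st m (s :: a) b c) 1 :=
  (Run.push _ _ _).of_eq (by simp [st]) le_rfl

/-- The program walks down the decision tree given by the codes of the four kinds of symbols. -/
theorem run_unloadTop (s : Symbol) (m a : List Symbol) :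
    Run unloadTop (st (str s ++ m) a [] []) (st m (s :: a) [] []) 7 := by
  cases s with
  | bit b =>
    exact (((Run.copyTop _ _ _).seq (Run.pop _ _)).iteFalse
      (by simp [st, str, enc, encSymbol, Data.str])).of_eq
      (by simp [st, str, enc, encSymbol, Data.str]) (by omega)
  | slash =>
    exact (((run_popM _ _ _ _ _).seq (((run_popM _ _ _ _ _).seq (((run_popM _ _ _ _ _).seq
      (run_pushA _ _ _ _ _)).iteTrue (by simp [st]))).iteTrue (by simp [st]))).iteTrue
      rfl).weaken (by omega)
  | comma =>
    exact (((run_popM _ _ _ _ _).seq (((run_popM _ _ _ _ _).seq (((run_popM _ _ _ _ _).seq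
      (run_pushA _ _ _ _ _)).iteFalse (by simp [st]))).iteTrue (by simp [st]))).iteTrue
      rfl).weaken (by omega)
  | semicolon =>
    exact (((run_popM _ _ _ _ _).seq (((run_popM _ _ _ _ _).seq ((run_popM _ _ _ _ _).seq
      (run_pushA _ _ _ _ _))).iteFalse (by simp [st]))).iteTrue
      rfl).weaken (by omega)

/-- Move the symbols of the list on top of `M` to `A`. -/
def unloadAll : Prog := loop .M (fun s => s = some .comma) (seq (pop .M) unloadTop)

theorem run_unloadAll (l a : List Symbol) :
    Run unloadAll (st (str l) a [] []) (st [.bit false] (l.reverse ++ a) [] [])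
      (9 * l.length + 1) := by
  induction l generalizing a with
  | nil => exact Run.loopFalse rfl
  | cons s l ih =>
    refine (Run.loopTrue rfl ((run_popM _ _ _ _ _).seq
      (run_unloadTop s (str l) a)) (t' := 9 * l.length + 1)
      (S'' := _) ?_).weaken (by simp; omega)
    simpa using! ih (s :: a)

/-- Write the output. -/
def unload : Prog := seq unloadAll (seq (pop .M) (transfer .A .B))

theorem run_unload (l : List Symbol) :
    Run unload (st (str l) [] [] []) (st [] [] l []) (12 * l.length + 3) :=
  ((run_unloadAll l []).seq ((run_popM _ _ _ _ _).seq
    (run_transferAB _ _ _ _))).of_eq (by simp) (by simp; omega)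

/-- Functions that are computed in polynomial time on coded data are computed in polynomial time
by Turing machines. -/
theorem PT.computable {I O : Type} {ei : I → List Symbol} {eo : O → List Symbol} {g : I → O}
    {f : List Symbol → List Symbol} (hf : PT f) (h : ∀ x, f (ei x) = eo (g x)) :
    Nonempty (Turing.TM2ComputableInPolyTime ei eo g) := by
  obtain ⟨Q, hQ⟩ := hf.size
  obtain ⟨p, P, hp⟩ := hf
  have hm : ∀ (R : Polynomial ℕ) (x : I), R.eval (sz (ei x)) ≤
      (R.comp (4 * .X + 1)).eval (ei x).length := fun R x => by
    simpa [Polynomial.eval_comp] using eval_mono R (sz_symbols_le (ei x))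
  refine computable_of_run (seq load (seq p unload))
    (13 * .X + 3 + (P.comp (4 * .X + 1) + (12 * Q.comp (4 * .X + 1) + 3))) fun x => ?_
  have h₁ := hp (ei x) []
  rw [List.append_nil, List.append_nil, h] at h₁
  refine ((run_load (ei x)).seq ((h₁.weaken (hm P x)).seq
    ((run_unload (eo (g x))).weaken (t' := 12 * (Q.comp (4 * .X + 1)).eval (ei x).length + 3)
      ?_))).weaken ?_
  · have h₂ := (hQ (ei x)).trans (hm Q x)
    simp only [h] at h₂
    have := length_lt_sz (eo (g x))
    omega
  · simp

end PolyTime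

namespace PolyTime

open Prec Function Coded

section

variable {α β γ δ : Type} [Coded α] [Coded β] [Coded γ] [Coded δ]

/-! ### Lists -/

namespace PT

@[fun_prop]
theorem cons {f : α → β} {l : α → List β} (hf : PT f) (hl : PT l) : PT fun a => f a :: l a :=
  of_enc (prodMk hf hl)

@[fun_prop]
theorem isEmpty {l : α → List β} (hl : PT l) : PT fun a => (l a).isEmpty := by
  have h : PT fun d : Data => _root_.cond d.isNode false true := by
    have := isNode
    fun_prop
  refine PT.comp (g := List.isEmpty) ?_ hl
  obtain ⟨p, P, hp⟩ := h
  refine ⟨p, P, fun a m => ?_⟩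
  have := hp (enc a) m
  cases a <;> exact this

@[fun_prop]
theorem tail {l : α → List β} (hl : PT l) : PT fun a => (l a).tail := by
  have h : PT fun d : Data => _root_.cond d.isNode d.right d := by
    have h₁ := isNode
    have h₂ := right
    fun_prop
  refine PT.comp (g := List.tail) ?_ hl
  obtain ⟨p, P, hp⟩ := h
  refine ⟨p, P, fun a m => ?_⟩
  have := hp (enc a) m
  cases a <;> exact this

@[fun_prop]
theorem headI [Inhabited β] {l : α → List β} (hl : PT l) : PT fun a => (l a).headI := by
  have h : PT fun d : Data => _root_.cond d.isNode d.left (enc (default : β)) := by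
    have h₁ := isNode
    have h₂ := left
    fun_prop
  refine PT.comp (g := List.headI) ?_ hl
  obtain ⟨p, P, hp⟩ := h
  refine ⟨p, P, fun a m => ?_⟩
  have := hp (enc a) m
  cases a <;> exact this

@[fun_prop]
theorem and {f g : α → Bool} (hf : PT f) (hg : PT g) : PT fun a => f a && g a := by
  have : (fun a => f a && g a) = fun a => _root_.cond (f a) (g a) false := by
    funext a; cases f a <;> rfl
  rw [this]
  fun_prop

@[fun_prop]
theorem not {f : α → Bool} (hf : PT f) : PT fun a => !f a := by
  have : (fun a => !f a) = fun a => _root_.cond (f a) false true := by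
    funext a; cases f a <;> rfl
  rw [this]
  fun_prop

@[fun_prop]
theorem or {f g : α → Bool} (hf : PT f) (hg : PT g) : PT fun a => f a || g a := by
  have : (fun a => f a || g a) = fun a => _root_.cond (f a) true (g a) := by
    funext a; cases f a <;> rfl
  rw [this]
  fun_prop

@[fun_prop]
theorem xor {f g : α → Bool} (hf : PT f) (hg : PT g) : PT fun a => Bool.xor (f a) (g a) := by
  have : (fun a => Bool.xor (f a) (g a)) = fun a => _root_.cond (f a) (!g a) (g a) := by
    funext a; cases f a <;> cases g a <;> rfl
  rw [this]
  fun_prop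

/-! ### Recursion schemes -/

/-- The list of the first `k` iterates in reverse order. -/
def path (n : β → β) (x : β) : ℕ → List β
  | 0 => []
  | k + 1 => n^[k] x :: path n x k

theorem sz_path_le (n : β → β) (x : β) {b : ℕ} (h : ∀ i, sz (n^[i] x) ≤ b) (k : ℕ) :
    sz (path n x k) ≤ k * (b + 1) + 1 := by
  induction k with
  | zero => simp [path]
  | succ k ih =>
    have := h k
    simp only [path, sz_cons]
    rw [add_mul]
    omega

/-- Linear recursion: `f x` is `g x` if `c x`, and is obtained from `f (n x)` otherwise. -/
theorem linearRec [Inhabited β] {s : α → β} {c : β → Bool} {n : β → β} {g f : β → γ}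
    {h : β × γ → γ} (hs : PT s) (hc : PT c) (hn : PT n) (hg : PT g) (hh : PT h)
    (hf : ∀ x, f x = bif c x then g x else h (x, f (n x))) {μ : β → ℕ}
    (hμ : ∀ x, c x = false → μ (n x) < μ x) {B : α → ℕ} (hB : PB B) (hμB : ∀ a, μ (s a) ≤ B a)
    (hnB : ∀ a i, sz (n^[i] (s a)) ≤ B a) (hfB : ∀ a i, sz (f (n^[i] (s a))) ≤ B a) :
    PT fun a => f (s a) := by
  -- The measure drops as long as the recursion continues, so the stopping condition is met within
  -- `μ x` steps; `N a` is the first time this happens.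
  have hex : ∀ m x, μ x ≤ m → ∃ k ≤ m, c (n^[k] x) = true := by
    intro m
    induction m with
    | zero =>
      intro x hx
      refine ⟨0, le_rfl, ?_⟩
      by_contra hcx
      have := hμ x (by simpa using hcx)
      omega
    | succ m ih =>
      intro x hx
      by_cases hcx : c x = true
      · exact ⟨0, by omega, hcx⟩
      · have := hμ x (by simpa using hcx)
        obtain ⟨k, hk, hck⟩ := ih (n x) (by omega)
        exact ⟨k + 1, by omega, hck⟩
  have hex' : ∀ a, ∃ k, c (n^[k] (s a)) = true := fun a =>
    (hex _ (s a) le_rfl).imp fun _ h => h.2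
  classical
  let N : α → ℕ := fun a => Nat.find (hex' a)
  have hN : ∀ a, c (n^[N a] (s a)) = true := fun a => Nat.find_spec (hex' a)
  have hN' : ∀ a, ∀ i < N a, c (n^[i] (s a)) = false := fun a i hi => by
    simpa using Nat.find_min (hex' a) hi
  have hNB : ∀ a, N a ≤ B a := fun a => by
    obtain ⟨k, hk, hck⟩ := hex _ (s a) le_rfl
    exact (Nat.find_min' (hex' a) hck).trans (hk.trans (hμB a))
  -- Recursion becomes two loops. The first descends to the base case and records the arguments met
  -- on the way, the latest on top.
  have hit₁ : ∀ x k, (fun p : β × List β => (n p.1, p.1 :: p.2))^[k] (x, []) =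
      (n^[k] x, path n x k) := by
    intro x k
    induction k with
    | zero => rfl
    | succ k ih => rw [iterate_succ_apply', ih, iterate_succ_apply']; rfl
  have hB' : PB fun a => B a * (B a + 1) + 1 + B a + 1 :=
    (((hB.mul (hB.add (PB.const 1))).add (PB.const 1)).add hB).add (PB.const 1)
  have hpath : ∀ a, ∀ k ≤ N a, sz (path n (s a) k) ≤ B a * (B a + 1) + 1 := fun a k hk =>
    (sz_path_le n (s a) (hnB a) k).trans (by gcongr; exact hk.trans (hNB a))
  have hphase₁ : PT fun a => (n^[N a] (s a), path n (s a) (N a)) := by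
    have : PT fun a => (fun p : β × List β => (n p.1, p.1 :: p.2))^[N a] (s a, []) := by
      refine iterate (s := fun a => (s a, ([] : List β))) (c := fun p => !c p.1)
        (f := fun p => (n p.1, p.1 :: p.2)) (by fun_prop) (by fun_prop) (by fun_prop) hB' ?_ ?_ ?_ ?_
      · intro a; have := hNB a; nlinarith
      · intro a i hi; rw [hit₁]; simp [hN' a i hi]
      · intro a; rw [hit₁]; simp [hN a]
      · intro a i hi
        rw [hit₁]
        have := hnB a i
        have := hpath a i hi
        simp; omega
    simpa only [hit₁] using this
  -- The second loop climbs back: it takes the recorded arguments from the top and applies `h`,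
  -- until none is left.
  have hit₂ : ∀ a, ∀ k ≤ N a,
      (fun p : γ × List β => (h (p.2.headI, p.1), p.2.tail))^[k]
        (f (n^[N a] (s a)), path n (s a) (N a)) =
      (f (n^[N a - k] (s a)), path n (s a) (N a - k)) := by
    intro a k hk
    induction k with
    | zero => rfl
    | succ k ih =>
      rw [iterate_succ_apply', ih (by omega)]
      have e : N a - k = N a - (k + 1) + 1 := by omega
      rw [e]
      simp only [path, List.headI, List.tail]
      rw [hf (n^[N a - (k + 1)] (s a)), hN' a _ (by omega), iterate_succ_apply']
      rfl
  have hphase₂ : PT fun a => (fun p : γ × List β => (h (p.2.headI, p.1), p.2.tail))^[N a]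
      (f (n^[N a] (s a)), path n (s a) (N a)) := by
    refine iterate (s := fun a => (f (n^[N a] (s a)), path n (s a) (N a)))
      (c := fun p => !p.2.isEmpty)
      (f := fun p : γ × List β => (h (p.2.headI, p.1), p.2.tail)) ?_ (by fun_prop)
      (by fun_prop) hB' ?_ ?_ ?_ ?_
    · have : (fun a => (f (n^[N a] (s a)), path n (s a) (N a))) =
          fun a => (fun p : β × List β => (g p.1, p.2)) (n^[N a] (s a), path n (s a) (N a)) := by
        funext a
        rw [hf, hN]; rfl
      rw [this]
      exact PT.comp (g := fun p : β × List β => (g p.1, p.2)) (by fun_prop) hphase₁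
    · intro a; have := hNB a; nlinarith
    · intro a i hi
      rw [hit₂ a i hi.le]
      obtain ⟨j, hj⟩ : ∃ j, N a - i = j + 1 := ⟨N a - i - 1, by omega⟩
      simp [hj, path]
    · intro a; rw [hit₂ a _ le_rfl]; simp [path]
    · intro a i hi
      rw [hit₂ a i hi]
      have := hfB a (N a - i)
      have := hpath a (N a - i) (by omega)
      simp; omega
  have := hphase₂.fst
  simpa only [hit₂ _ _ le_rfl, Nat.sub_self, iterate_zero, id_eq] using! this

/-- Linear recursion in which the argument does not grow. -/
theorem linearRec' [Inhabited β] {c : β → Bool} {n : β → β} {g f : β → γ}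
    {h : β × γ → γ} (hc : PT c) (hn : PT n) (hg : PT g) (hh : PT h)
    (hf : ∀ x, f x = bif c x then g x else h (x, f (n x))) {μ : β → ℕ}
    (hμ : ∀ x, c x = false → μ (n x) < μ x) (hμB : PB μ)
    (hnB : ∀ x, sz (n x) ≤ sz x) (hfB : PB fun x => sz (f x)) : PT f := by
  have hi : ∀ x i, sz (n^[i] x) ≤ sz x := fun x i => by
    induction i with
    | zero => exact le_rfl
    | succ i ih => rw [iterate_succ_apply']; exact (hnB _).trans ih
  obtain ⟨P, hP⟩ := hfB
  refine linearRec (s := fun x => x) id hc hn hg hh hf hμ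
    (B := fun x => μ x + (sz x + P.eval (sz x))) (hμB.add (PB.size.add (PB.size.eval P))) ?_ ?_ ?_
  · intro a; omega
  · intro a i; have := hi a i; omega
  · intro a i; have := (hP (n^[i] a)).trans (eval_mono P (hi a i)); simp only at this; omega

theorem iterate_tail {ι κ : Type} (x : ι) (l : List κ) (i : ℕ) :
    (fun p : ι × List κ => (p.1, p.2.tail))^[i] (x, l) = (x, l.drop i) := by
  induction i with
  | zero => simp
  | succ i ih => rw [iterate_succ_apply', ih]; simp

end PT

/-! ### Sizes of lists -/

theorem sz_lt_of_mem {l : List α} {a : α} (h : a ∈ l) : sz a < sz l := by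
  induction l with
  | nil => simp at h
  | cons b l ih =>
    simp only [List.mem_cons] at h
    rw [sz_cons]
    rcases h with rfl | h
    · omega
    · have := ih h; omega

theorem sz_list_le {l : List α} {k : ℕ} (h : ∀ a ∈ l, sz a ≤ k) :
    sz l ≤ l.length * (k + 1) + 1 := by
  induction l with
  | nil => simp
  | cons a l ih =>
    have := ih fun b hb => h b (by simp [hb])
    have := h a (by simp)
    simp [add_mul]
    omega

theorem sz_append_le (l k : List α) : sz (l ++ k) ≤ sz l + sz k := by
  induction l with
  | nil => simp
  | cons a l ih => simp; omega

theorem sz_flatten_le (l : List (List α)) : sz l.flatten ≤ sz l := by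
  induction l with
  | nil => simp
  | cons a l ih => have := sz_append_le a l.flatten; simp; omega

theorem sz_suffix_le {l k : List α} (h : l <:+ k) : sz l ≤ sz k := by
  obtain ⟨t, rfl⟩ := h
  induction t with
  | nil => simp
  | cons a t ih => simp; omega

/-! ### List combinators -/

namespace PT

/-- Linear recursion along the list. A polynomial bound for all intermediate results has to be
supplied, since repeating a polynomial-time step may make sizes explode. -/
theorem foldr [Inhabited α] [Inhabited γ] {l : γ → List α} {i : γ → β} {f : γ → α → β → β}
    (hl : PT l) (hi : PT i) (hf : PT fun p : γ × α × β => f p.1 p.2.1 p.2.2) {B : γ → ℕ}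
    (hB : PB B) (h : ∀ x l', l' <:+ l x → sz (l'.foldr (f x) (i x)) ≤ B x) :
    PT fun x => (l x).foldr (f x) (i x) := by
  refine linearRec (s := fun x => (x, l x)) (c := fun p => p.2.isEmpty)
    (n := fun p : γ × List α => (p.1, p.2.tail)) (g := fun p => i p.1)
    (f := fun p => p.2.foldr (f p.1) (i p.1))
    (h := fun q : (γ × List α) × β => f q.1.1 q.1.2.headI q.2) (by fun_prop) (by fun_prop)
    (by fun_prop) (by fun_prop) ?_ ?_ (μ := fun p => p.2.length) ?_
    (B := fun x => B x + (sz x + sz (l x) + 1)) ?_ ?_ ?_ ?_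
  · exact hf.comp (f := fun q : (γ × List α) × β => (q.1.1, q.1.2.headI, q.2)) (by fun_prop)
  · rintro ⟨x, _ | ⟨a, l⟩⟩ <;> rfl
  · rintro ⟨x, _ | ⟨a, l⟩⟩ <;> simp
  · exact hB.add ((PB.size.add hl.size).add (PB.const 1))
  · intro a; have := length_lt_sz (l a); simp only; omega
  · intro x k
    rw [iterate_tail, sz_prod]
    have := sz_suffix_le (List.drop_suffix k (l x))
    simp only
    omega
  · intro x k
    rw [iterate_tail]
    have := h x _ (List.drop_suffix k (l x))
    simp only
    omega

@[fun_prop]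
theorem map [Inhabited α] [Inhabited γ] {l : γ → List α} {f : γ → α → β} (hl : PT l)
    (hf : PT fun p : γ × α => f p.1 p.2) : PT fun x => (l x).map (f x) := by
  obtain ⟨P, hP⟩ := hf.size
  have : (fun x => (l x).map (f x)) = fun x => (l x).foldr (fun a r => f x a :: r) [] := by
    funext x
    induction l x with
    | nil => rfl
    | cons a l ih => simp
  rw [this]
  have hm : ∀ x l', l' <:+ l x →
      l'.foldr (fun a r => f x a :: r) [] = l'.map (f x) := fun x l' _ => by
    induction l' with
    | nil => rfl
    | cons a l ih => simp
  refine foldr (f := fun x a r => f x a :: r) hl (by fun_prop) ?_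
    (B := fun x => sz (l x) * (P.eval (sz x + sz (l x) + 1) + 1) + 1) ?_ ?_
  · exact (hf.comp (f := fun p : γ × α × List β => (p.1, p.2.1)) (by fun_prop)).cons
      (by fun_prop)
  · exact (hl.size.mul ((((PB.size.add hl.size).add (PB.const 1)).eval P).add (PB.const 1))).add
      (PB.const 1)
  · intro x l' hl'
    rw [hm x l' hl']
    refine (sz_list_le (k := P.eval (sz x + sz (l x) + 1)) ?_).trans ?_
    · simp only [List.mem_map, forall_exists_index, and_imp, forall_apply_eq_imp_iff₂]
      intro a ha
      refine (hP (x, a)).trans (eval_mono P ?_)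
      have := sz_lt_of_mem (hl'.mem ha)
      simp; omega
    · have h₁ := length_lt_sz l'
      have h₂ := sz_suffix_le hl'
      rw [List.length_map]
      gcongr
      omega

@[fun_prop]
theorem append [Inhabited α] [Inhabited γ] {l k : γ → List α} (hl : PT l) (hk : PT k) :
    PT fun x => l x ++ k x := by
  have hm : ∀ x (l' : List α), l'.foldr (fun a r => a :: r) (k x) = l' ++ k x := fun x l' => by
    induction l' with
    | nil => rfl
    | cons a l ih => simp
  simp only [← hm]
  refine foldr (f := fun _ a r => a :: r) hl hk (by fun_prop) (hl.size.add hk.size) ?_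
  intro x l' hl'
  rw [hm]
  have := sz_suffix_le hl'
  have := sz_append_le l' (k x)
  omega

@[fun_prop]
theorem flatten [Inhabited α] [Inhabited γ] {l : γ → List (List α)} (hl : PT l) :
    PT fun x => (l x).flatten := by
  have hm : ∀ l' : List (List α), l'.foldr (fun a r => a ++ r) [] = l'.flatten := fun l' => by
    induction l' with
    | nil => rfl
    | cons a l ih => simp [ih]
  simp only [← hm]
  refine foldr (f := fun _ a r => a ++ r) hl (by fun_prop) (by fun_prop) hl.size ?_
  intro x l' hl'
  rw [hm]
  exact (sz_flatten_le l').trans (sz_suffix_le hl')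

@[fun_prop]
theorem flatMap [Inhabited α] [Inhabited β] [Inhabited γ] {l : γ → List α} {f : γ → α → List β}
    (hl : PT l) (hf : PT fun p : γ × α => f p.1 p.2) : PT fun x => (l x).flatMap (f x) := by
  simp only [List.flatMap_def]
  exact flatten (map hl hf)

end PT

end

end PolyTime

namespace PolyTime

open Prec Function Coded

/-! ### Arithmetic of natural numbers -/

instance : Coded ℕ := ⟨fun n => enc (Computability.encodeNat n)⟩

/-- Digits come lowest first, so appending a low digit is a cons. Zero is excluded because its digit
list is empty rather than a single `false`. -/
theorem encodeNat_bit (b : Bool) (n : ℕ) (h : Nat.bit b n ≠ 0) :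
    Computability.encodeNat (Nat.bit b n) = b :: Computability.encodeNat n := by
  unfold Computability.encodeNat
  rw [show ((Nat.bit b n : ℕ) : Num) = Num.ofNat' (Nat.bit b n) from (Num.ofNat'_eq _).symm,
    show ((n : ℕ) : Num) = Num.ofNat' n from (Num.ofNat'_eq _).symm, Num.ofNat'_bit]
  rcases hn : Num.ofNat' n with _ | p
  · have hn0 : n = 0 := by
      have := congrArg (fun m : Num => (m : ℕ)) hn
      simpa [Num.ofNat'_eq] using this
    subst hn0
    cases b
    · simp at h
    · rfl
  · cases b <;> rfl

theorem enc_bit (b : Bool) (n : ℕ) (h : Nat.bit b n ≠ 0) :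
    enc (Nat.bit b n) = Data.node (.leaf b) (enc n) := by
  simp only [enc, encodeNat_bit b n h, encList]

theorem sz_nat (n : ℕ) : sz n = 2 * n.size + 1 := by
  induction n using Nat.binaryRec' with
  | zero => rfl
  | bit b n h ih =>
    by_cases h0 : Nat.bit b n = 0
    · rw [h0]; rfl
    · rw [Nat.size_bit h0]
      have : sz (Nat.bit b n) = sz b + sz n + 1 := by
        simp [sz, str, enc_bit b n h0, Data.str]; simp [enc, Data.str]; omega
      rw [this, ih, sz_bool]; omega

/-- From `(a + 1) * (b + 1) ≥ a + b + 1`. The absence of an additive constant lets repeated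
additions be bounded by the total size of the summands. -/
theorem size_add_le (a b : ℕ) : (a + b).size ≤ a.size + b.size := by
  rw [Nat.size_le, pow_add]
  have h₁ := Nat.lt_size_self a
  have h₂ := Nat.lt_size_self b
  nlinarith

theorem size_mul_le (a b : ℕ) : (a * b).size ≤ a.size + b.size := by
  rw [Nat.size_le, pow_add]
  exact Nat.mul_lt_mul'' (Nat.lt_size_self a) (Nat.lt_size_self b)

theorem sz_add_le (a b : ℕ) : sz (a + b) ≤ sz a + sz b := by
  have := size_add_le a b
  simp only [sz_nat]; omega

theorem sz_mul_le (a b : ℕ) : sz (a * b) ≤ sz a + sz b := by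
  have := size_mul_le a b
  simp only [sz_nat]; omega

theorem sz_mono {a b : ℕ} (h : a ≤ b) : sz a ≤ sz b := by
  have := Nat.size_le_size h
  simp only [sz_nat]; omega

namespace PT

variable {α : Type} [Coded α]

theorem of_enc_fun {β γ : Type} [Coded β] [Coded γ] {f : β → γ} {F : Data → Data} (hF : PT F)
    (h : ∀ b, F (enc b) = enc (f b)) : PT f := by
  obtain ⟨p, P, hp⟩ := hF
  refine ⟨p, P, fun a m => ?_⟩
  have := hp (enc a) m
  rw [h] at this
  exact this

@[fun_prop]
theorem bodd {f : α → ℕ} (hf : PT f) : PT fun a => (f a).bodd := by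
  refine PT.comp (g := Nat.bodd) (of_enc_fun left fun n => ?_) hf
  induction n using Nat.bitCasesOn with
  | bit b n =>
    by_cases h : Nat.bit b n = 0
    -- Zero is coded by the leaf `false`, which is its own left subtree and also codes the Boolean
    -- `false`.
    · rw [h]; rfl
    · rw [enc_bit b n h]; simp [Data.left, enc]

@[fun_prop]
theorem div2 {f : α → ℕ} (hf : PT f) : PT fun a => (f a).div2 := by
  refine PT.comp (g := Nat.div2) (of_enc_fun right fun n => ?_) hf
  induction n using Nat.bitCasesOn with
  | bit b n =>
    by_cases h : Nat.bit b n = 0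
    · rw [h]; rfl
    · rw [enc_bit b n h]; simp [Data.right]

@[fun_prop]
theorem eq_zero {f : α → ℕ} (hf : PT f) : PT fun a => decide (f a = 0) := by
  have h : PT fun d : Data => enc !d.isNode := of_enc (isNode.not)
  refine PT.comp (g := fun n => decide (n = 0)) (of_enc_fun h fun n => ?_) hf
  induction n using Nat.bitCasesOn with
  | bit b n =>
    by_cases h : Nat.bit b n = 0
    · rw [h]; rfl
    · rw [enc_bit b n h]; simp [Data.isNode, h]

-- A cons of codes, except that a digit `false` in front of zero must be suppressed to keep the
-- representation canonical.
@[fun_prop]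
theorem bit {b : α → Bool} {f : α → ℕ} (hb : PT b) (hf : PT f) : PT fun a => Nat.bit (b a) (f a) := by
  have h : PT fun p : Bool × ℕ =>
      _root_.cond (!p.1 && decide (p.2 = 0)) (enc (0 : ℕ)) (enc p) := by
    have : PT fun p : Bool × ℕ => enc p := of_enc_eq fun _ => rfl
    fun_prop
  refine PT.comp (g := fun p : Bool × ℕ => Nat.bit p.1 p.2) (of_enc ?_) (hb.prodMk hf)
  convert h using 2 with p
  obtain ⟨b, n⟩ := p
  by_cases h : Nat.bit b n = 0
  · obtain ⟨rfl, rfl⟩ : n = 0 ∧ b = false := by simpa [Nat.bit_eq_zero_iff] using h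
    rfl
  · rw [enc_bit b n h]
    cases b
    · have hn : n ≠ 0 := by rintro rfl; exact h rfl
      simp [hn]; rfl
    · rfl

theorem sz_div2_le (n : ℕ) : sz n.div2 ≤ sz n :=
  sz_mono (by rw [Nat.div2_val]; omega)

theorem div2_size_lt {n : ℕ} (h : n ≠ 0) : n.div2.size < n.size := by
  induction n using Nat.bitCasesOn with
  | bit b n => rw [Nat.size_bit h]; simp

theorem div2_size_le (n : ℕ) : n.div2.size ≤ n.size :=
  Nat.size_le_size (by rw [Nat.div2_val]; omega)

theorem eq_bodd_div2 (n : ℕ) : n = n.bodd.toNat + 2 * n.div2 := by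
  conv_lhs => rw [← Nat.bit_bodd_div2 n]
  rw [Nat.bit_val]; omega

/-- Schoolbook addition: the new carry is the majority of the two low digits and the old carry, and
the result digit is their parity. -/
theorem addCarry : PT fun x : ℕ × ℕ × Bool => x.1 + x.2.1 + x.2.2.toNat := by
  refine linearRec' (c := fun x => decide (x.1 = 0) && decide (x.2.1 = 0))
    (n := fun x => (x.1.div2, x.2.1.div2,
      bif x.1.bodd then x.2.1.bodd || x.2.2 else x.2.1.bodd && x.2.2))
    (g := fun x => bif x.2.2 then 1 else 0)
    (h := fun y => Nat.bit (Bool.xor y.1.1.bodd (Bool.xor y.1.2.1.bodd y.1.2.2)) y.2)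
    (by fun_prop) (by fun_prop) (by fun_prop) (by fun_prop) ?_
    (μ := fun x => x.1.size + x.2.1.size) ?_ ?_ ?_ ?_
  · rintro ⟨a, b, c⟩
    by_cases h : a = 0 ∧ b = 0
    · obtain ⟨rfl, rfl⟩ := h
      cases c <;> rfl
    · have : (decide (a = 0) && decide (b = 0)) = false := by simpa using h
      simp only [this, cond_false, Nat.bit_val]
      have ha := eq_bodd_div2 a
      have hb := eq_bodd_div2 b
      generalize a.bodd = a' at *
      generalize b.bodd = b' at *
      cases a' <;> cases b' <;> cases c <;> simp at ha hb ⊢ <;> omega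
  · rintro ⟨a, b, c⟩ h
    simp only [Bool.and_eq_false_iff, decide_eq_false_iff_not] at h
    have ha := div2_size_le a
    have hb := div2_size_le b
    rcases h with h | h <;> have := div2_size_lt h <;> simp only <;> omega
  · exact PB.size.mono fun x => by simp [sz_nat]; omega
  · rintro ⟨a, b, c⟩
    have ha := sz_div2_le a
    have hb := sz_div2_le b
    simp; omega
  · refine (PB.size.add (PB.const 3)).mono fun ⟨a, b, c⟩ => ?_
    have h₁ := sz_add_le (a + b) c.toNat
    have h₂ := sz_add_le a b
    have h₃ : sz c.toNat ≤ 3 := by cases c <;> simp [sz_nat]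
    simp; omega

@[fun_prop]
theorem add {f g : α → ℕ} (hf : PT f) (hg : PT g) : PT fun a => f a + g a :=
  addCarry.comp (f := fun a => (f a, g a, false)) (by fun_prop)

-- Shift-and-add along the binary digits of the first factor.
@[fun_prop]
theorem mul {f g : α → ℕ} (hf : PT f) (hg : PT g) : PT fun a => f a * g a := by
  refine PT.comp (g := fun x : ℕ × ℕ => x.1 * x.2) ?_ (hf.prodMk hg)
  refine linearRec' (c := fun x => decide (x.1 = 0)) (n := fun x => (x.1.div2, x.2))
    (g := fun x => 0) (h := fun y => Nat.bit false y.2 + bif y.1.1.bodd then y.1.2 else 0)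
    (by fun_prop) (by fun_prop) (by fun_prop) (by fun_prop) ?_ (μ := fun x => x.1.size) ?_ ?_ ?_ ?_
  · rintro ⟨a, b⟩
    by_cases h : a = 0
    · simp [h]
    · simp only [h, decide_false, cond_false, Nat.bit_val]
      conv_lhs => rw [eq_bodd_div2 a]
      cases a.bodd <;> simp <;> ring
  · rintro ⟨a, b⟩ h
    exact div2_size_lt (by simpa using h)
  · exact PB.size.mono fun x => by simp [sz_nat]; omega
  · rintro ⟨a, b⟩
    have ha := sz_div2_le a
    simp; omega
  · refine PB.size.mono fun ⟨a, b⟩ => ?_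
    have h₁ := sz_mul_le a b
    simp; omega

/-- Comparison by subtraction from the low digits upwards: the Boolean is the borrow, and the
inequality holds iff no borrow remains at the end. -/
theorem leCarry : PT fun x : ℕ × ℕ × Bool => decide (x.1 + x.2.2.toNat ≤ x.2.1) := by
  refine linearRec' (c := fun x => decide (x.1 = 0) && decide (x.2.1 = 0))
    (n := fun x => (x.1.div2, x.2.1.div2,
      bif x.2.1.bodd then x.1.bodd && x.2.2 else x.1.bodd || x.2.2))
    (g := fun x => !x.2.2) (h := fun y => y.2)
    (by fun_prop) (by fun_prop) (by fun_prop) (by fun_prop) ?_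
    (μ := fun x => x.1.size + x.2.1.size) ?_ ?_ ?_ ?_
  · rintro ⟨a, b, c⟩
    by_cases h : a = 0 ∧ b = 0
    · obtain ⟨rfl, rfl⟩ := h
      cases c <;> rfl
    · have : (decide (a = 0) && decide (b = 0)) = false := by simpa using h
      simp only [this, cond_false, decide_eq_decide]
      have ha := eq_bodd_div2 a
      have hb := eq_bodd_div2 b
      generalize a.bodd = a' at *
      generalize b.bodd = b' at *
      cases a' <;> cases b' <;> cases c <;> simp at ha hb ⊢ <;> omega
  · rintro ⟨a, b, c⟩ h
    simp only [Bool.and_eq_false_iff, decide_eq_false_iff_not] at h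
    have ha := div2_size_le a
    have hb := div2_size_le b
    rcases h with h | h <;> have := div2_size_lt h <;> simp only <;> omega
  · exact PB.size.mono fun x => by simp [sz_nat]; omega
  · rintro ⟨a, b, c⟩
    have ha := sz_div2_le a
    have hb := sz_div2_le b
    simp; omega
  · exact (PB.const 1).mono fun x => by simp

@[fun_prop]
theorem decide_le {f g : α → ℕ} (hf : PT f) (hg : PT g) : PT fun a => decide (f a ≤ g a) :=
  leCarry.comp (f := fun a => (f a, g a, false)) (by fun_prop)

@[fun_prop]
theorem decide_eq {f g : α → ℕ} (hf : PT f) (hg : PT g) : PT fun a => decide (f a = g a) := by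
  have : (fun a => decide (f a = g a)) = fun a => decide (f a ≤ g a) && decide (g a ≤ f a) := by
    funext a
    rw [← Bool.decide_and, decide_eq_decide]
    omega
  rw [this]
  fun_prop

end PT

end PolyTime

namespace PolyTime

open Prec Function Coded

/-! ### Parsing -/

namespace Data

/-- The value of a leaf. -/
def isTrue : Data → Bool
  | leaf b => b
  | node _ _ => false

end Data

section

variable {α β γ : Type} [Coded α] [Coded β] [Coded γ]

open Prog in
theorem PT.isTrue : PT Data.isTrue := by
  refine of_run (t := fun d => 7 * sz d + 3 + 1 + 1)
    (ite .M (fun s => s = some (.bit true)) (seq drop (push .M (.bit true)))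
      (seq drop (push .M (.bit false)))) ?_ fun d m => ?_
  · exact ((((PB.const 7).mul PB.size).add (PB.const 3)).add (PB.const 1)).add (PB.const 1)
  · rcases d with ⟨_ | _⟩ | ⟨x, y⟩
    · exact Run.iteFalse rfl ((run_drop _ m []).seq (run_pushM _ _ _ _ _))
    · exact Run.iteTrue rfl ((run_drop _ m []).seq (run_pushM _ _ _ _ _))
    · exact Run.iteFalse rfl ((run_drop _ m []).seq (run_pushM _ _ _ _ _))

/-- Every function on symbols is computed in polynomial time. -/
theorem PT.of_symbol (f : Symbol → β) : PT f := by
  have h₁ := PT.isTrue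
  have h₂ := PT.isNode
  have h₃ := PT.left
  have h₄ := PT.right
  have h : PT fun d : Data => bif d.isNode then
      (bif d.left.isTrue then enc (f .semicolon) else
        bif d.right.isTrue then enc (f .comma) else enc (f .slash))
      else bif d.isTrue then enc (f (.bit true)) else enc (f (.bit false)) := by
    fun_prop
  refine PT.of_enc_fun h fun s => ?_
  rcases s with ⟨_ | _⟩ | _ | _ | _ <;> rfl

theorem PT.symbolBit {f : α → Bool} (hf : PT f) : PT fun a => Symbol.bit (f a) :=
  PT.of_enc hf

/-- Apply a function to the head of a list. -/
def onHead {α : Type} [Inhabited α] (f : α → α) (l : List α) : List α := f l.headI :: l.tail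

theorem PT.onHead [Inhabited α] {f : γ → α → α} {l : γ → List α}
    (hf : PT fun p : γ × α => f p.1 p.2) (hl : PT l) : PT fun x => onHead (f x) (l x) := by
  unfold PolyTime.onHead
  exact (hf.comp (f := fun x => (x, (l x).headI)) (by fun_prop)).cons (by fun_prop)

theorem sz_onHead_le (f : List α → List α) (k : ℕ)
    (h : ∀ a, sz (f a) ≤ sz a + k) (l : List (List α)) : sz (onHead f l) ≤ sz l + (k + 2) := by
  cases l with
  | nil =>
    have : sz (f default) ≤ 1 + k := h []
    simp [onHead]; omega
  | cons a l => have := h a; simp [onHead]; omega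

/-- A written number: the list of its parts. -/
abbrev Raw := List (List Bool)

/-- The effect of a symbol on the parsed columns to the right of it. -/
def parseStep (s : Symbol) (t : List (List Raw)) : List (List Raw) :=
  match s with
  | .bit b => onHead (onHead (onHead (b :: ·))) t
  | .slash => onHead (onHead ([] :: ·)) t
  | .comma => onHead ([[]] :: ·) t
  | .semicolon => [] :: t

/-- Split an input string into columns, numbers and parts. -/
def parse (l : List Symbol) : List (List Raw) := l.foldr parseStep []

/-- The new digit and each of the three levels of nesting cost at most 2, even where a missing head
has to be created. The growth is additive, so the parsed input is linear in the string. -/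
theorem sz_parseStep_le (s : Symbol) (t : List (List Raw)) : sz (parseStep s t) ≤ sz t + 8 := by
  cases s with
  | bit b =>
    refine sz_onHead_le _ 6 (fun a => ?_) t
    refine sz_onHead_le _ 4 (fun a => ?_) a
    refine sz_onHead_le _ 2 (fun a => ?_) a
    simp; omega
  | slash =>
    refine (sz_onHead_le _ 4 (fun a => ?_) t).trans (by omega)
    refine sz_onHead_le _ 2 (fun a => ?_) a
    simp; omega
  | comma =>
    refine (sz_onHead_le _ 4 (fun a => ?_) t).trans (by omega)
    simp; omega
  | semicolon => simp [parseStep]; omega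

theorem sz_parse_le (l : List Symbol) : sz (parse l) ≤ 8 * sz l := by
  induction l with
  | nil => simp [parse]
  | cons s l ih =>
    have := sz_parseStep_le s (parse l)
    simp only [parse, List.foldr_cons, sz_cons] at *
    omega

instance : Inhabited Symbol := ⟨.slash⟩

theorem PT.parseStep : PT fun p : Symbol × List (List Raw) => parseStep p.1 p.2 := by
  have h₁ : PT fun s : Symbol => s matches .bit _ := PT.of_symbol _
  have h₂ : PT fun s : Symbol => s matches .bit true := PT.of_symbol _
  have h₃ : PT fun s : Symbol => s matches .slash := PT.of_symbol _
  have h₄ : PT fun s : Symbol => s matches .comma := PT.of_symbol _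
  have e : (fun p : Symbol × List (List Raw) => PolyTime.parseStep p.1 p.2) = fun p =>
      bif p.1 matches .bit _ then
        PolyTime.onHead (PolyTime.onHead (PolyTime.onHead ((p.1 matches .bit true) :: ·))) p.2
      else bif p.1 matches .slash then PolyTime.onHead (PolyTime.onHead ([] :: ·)) p.2
      else bif p.1 matches .comma then PolyTime.onHead ([[]] :: ·) p.2 else [] :: p.2 := by
    funext p
    rcases p with ⟨⟨_ | _⟩ | _ | _ | _, t⟩ <;> rfl
  rw [e]
  refine PT.cond (h₁.comp (by fun_prop)) ?_ (PT.cond (h₃.comp (by fun_prop)) ?_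
    (PT.cond (h₄.comp (by fun_prop)) ?_ (by fun_prop)))
  · refine PT.onHead (PT.onHead (PT.onHead (PT.cons ?_ ?_) ?_) ?_) ?_
    · exact h₂.comp (f := fun p : ((((Symbol × List (List Raw)) × List Raw) × Raw) ×
        List Bool) => p.1.1.1.1) (by fun_prop)
    all_goals fun_prop
  · refine PT.onHead (PT.onHead ?_ ?_) ?_ <;> fun_prop
  · refine PT.onHead ?_ ?_ <;> fun_prop

theorem PT.parse : PT parse := by
  refine PT.foldr (γ := List Symbol) (l := fun l => l) (i := fun _ => [])
    (f := fun _ => PolyTime.parseStep) (by fun_prop) (by fun_prop) ?_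
    (B := fun l => 8 * sz l) ((PB.const 8).mul PB.size) ?_
  · exact PT.parseStep.comp (f := fun p : List Symbol × Symbol × List (List Raw) =>
      (p.2.1, p.2.2)) (by fun_prop)
  · intro x l' hl'
    exact (sz_parse_le l').trans (Nat.mul_le_mul_left _ (sz_suffix_le hl'))

/-! ### Decoding of numbers -/

/-- The number with given binary digits. -/
def natOfBits (l : List Bool) : ℕ := l.foldr Nat.bit 0

theorem natOfBits_encodeNat (n : ℕ) : natOfBits (Computability.encodeNat n) = n := by
  induction n using Nat.binaryRec' with
  | zero => rfl
  | bit b n h ih =>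
    by_cases h0 : Nat.bit b n = 0
    · rw [h0]; rfl
    · rw [encodeNat_bit b n h0]
      simp only [natOfBits, List.foldr_cons] at *
      rw [ih]

theorem sz_natOfBits_le (l : List Bool) : sz (natOfBits l) ≤ sz l := by
  induction l with
  | nil => simp [natOfBits, sz_nat]
  | cons b l ih =>
    simp only [natOfBits, List.foldr_cons, sz_cons, sz_bool, sz_nat] at *
    by_cases h : Nat.bit b (l.foldr Nat.bit 0) = 0
    · rw [h]; simp
    · rw [Nat.size_bit h]; omega

@[fun_prop]
theorem PT.natOfBits : PT natOfBits := by
  refine PT.foldr (γ := List Bool) (l := fun l => l) (i := fun _ => 0)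
    (f := fun _ => Nat.bit) (by fun_prop) (by fun_prop) (by fun_prop) PB.size ?_
  intro x l' hl'
  exact (sz_natOfBits_le l').trans (sz_suffix_le hl')

theorem sz_nat_le (n : ℕ) : sz n ≤ 2 * n + 1 := by
  have := Nat.size_le.2 (Nat.lt_two_pow_self (n := n))
  rw [sz_nat]; omega

@[fun_prop]
theorem PT.length [Inhabited α] : PT fun l : List α => l.length := by
  have e : ∀ l : List α, l.foldr (fun _ n => n + 1) 0 = l.length := fun l => by
    induction l with
    | nil => rfl
    | cons a l ih => simp [ih]
  simp only [← e]
  refine PT.foldr (γ := List α) (l := fun l => l) (i := fun _ => 0)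
    (f := fun _ _ n => n + 1) (by fun_prop) (by fun_prop) (by fun_prop)
    (((PB.const 2).mul PB.size).add (PB.const 1)) ?_
  intro x l' hl'
  rw [e]
  have h₁ := sz_nat_le l'.length
  have h₂ := sz_suffix_le hl'
  have h₃ := length_lt_sz l'
  omega

/-! ### Arithmetic of signed fractions -/

/-- The triple `(p, n, d)` stands for `(p - n) / d`, and `(0, 1, 0)` for `-∞`. -/
abbrev Ratio := ℕ × ℕ × ℕ

namespace Ratio

/-- Comparison. -/
def le (x y : Ratio) : Bool :=
  decide (x.1 * y.2.2 + y.2.1 * x.2.2 ≤ y.1 * x.2.2 + x.2.1 * y.2.2)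

/-- Product. -/
def mul (x y : Ratio) : Ratio :=
  (x.1 * y.1 + x.2.1 * y.2.1, x.1 * y.2.1 + x.2.1 * y.1, x.2.2 * y.2.2)

/-- Sum. -/
def add (x y : Ratio) : Ratio :=
  (x.1 * y.2.2 + y.1 * x.2.2, x.2.1 * y.2.2 + y.2.1 * x.2.2, x.2.2 * y.2.2)

/-- Maximum. -/
def max (x y : Ratio) : Ratio := bif le x y then y else x

end Ratio

@[fun_prop]
theorem PT.ratioLe {f g : α → Ratio} (hf : PT f) (hg : PT g) : PT fun a => (f a).le (g a) := by
  unfold Ratio.le; fun_prop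

@[fun_prop]
theorem PT.ratioMul {f g : α → Ratio} (hf : PT f) (hg : PT g) : PT fun a => (f a).mul (g a) := by
  unfold Ratio.mul; fun_prop

@[fun_prop]
theorem PT.ratioAdd {f g : α → Ratio} (hf : PT f) (hg : PT g) : PT fun a => (f a).add (g a) := by
  unfold Ratio.add; fun_prop

@[fun_prop]
theorem PT.ratioMax {f g : α → Ratio} (hf : PT f) (hg : PT g) : PT fun a => (f a).max (g a) := by
  unfold Ratio.max; fun_prop

/-- The value of a binary fraction. -/
def decodeFraction (r : Raw) : Ratio :=
  bif Bool.xor r.headI.headI r.tail.headI.headI then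
    (0, natOfBits r.headI.tail, natOfBits r.tail.headI.tail)
  else (natOfBits r.headI.tail, 0, natOfBits r.tail.headI.tail)

/-- The value of a unary integer. -/
def decodeUnary (r : Raw) : Ratio :=
  bif r.headI.headI then (0, r.headI.tail.length, 1) else (r.headI.tail.length, 0, 1)

/-- The absolute values of numerator and denominator of a binary fraction. -/
def decodeProb (r : Raw) : ℕ × ℕ :=
  (natOfBits r.headI.tail, natOfBits r.tail.headI.tail)

@[fun_prop]
theorem PT.decodeFraction : PT decodeFraction := by
  unfold PolyTime.decodeFraction; fun_prop

@[fun_prop]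
theorem PT.decodeUnary : PT decodeUnary := by
  unfold PolyTime.decodeUnary; fun_prop

@[fun_prop]
theorem PT.decodeProb : PT decodeProb := by
  unfold PolyTime.decodeProb; fun_prop

/-- Group the entries of a list into pairs. -/
def pairUp {α : Type} : List α → List (α × α)
  | a :: b :: l => (a, b) :: pairUp l
  | _ => []

theorem sz_pairUp_le (l : List α) : sz (pairUp l) ≤ sz l := by
  induction l using pairUp.induct with
  | case1 a b l ih => simp [pairUp]; omega
  | case2 l h =>
    have : pairUp l = [] := by
      rcases l with _ | ⟨a, _ | ⟨b, l⟩⟩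
      · rfl
      · rfl
      · exact (h a b l rfl).elim
    rw [this]
    exact sz_pos l

@[fun_prop]
theorem PT.pairUp [Inhabited α] : PT fun l : List α => pairUp l := by
  refine PT.linearRec' (c := fun l : List α => l.isEmpty || l.tail.isEmpty)
    (n := fun l => l.tail.tail) (g := fun _ => [])
    (h := fun y => (y.1.headI, y.1.tail.headI) :: y.2) (by fun_prop) (by fun_prop) (by fun_prop)
    (by fun_prop) ?_ (μ := fun l => l.length) ?_ (PB.size.mono fun l => (length_lt_sz l).le) ?_
    (PB.size.mono sz_pairUp_le)
  · rintro (_ | ⟨a, _ | ⟨b, l⟩⟩) <;> rfl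
  · rintro (_ | ⟨a, _ | ⟨b, l⟩⟩) <;> simp
  · rintro (_ | ⟨a, _ | ⟨b, l⟩⟩) <;> simp
    omega

end

end PolyTime

namespace PolyTime

open Prec Function Coded

/-! ### The algorithm -/

/-- A pair of scores. -/
abbrev State := Ratio × Ratio

/-- A column: its two entries, and the list of weights, each with numerator and denominator of its
probability. -/
abbrev Column := Ratio × Ratio × List (Ratio × ℕ × ℕ)

/-- Replace fractions by numerators over a common denominator. -/
def common (l : List (Ratio × ℕ × ℕ)) : List (Ratio × ℕ) × ℕ :=
  l.foldr (fun e r => ((e.1, e.2.1 * r.2) :: r.1.map fun v => (v.1, v.2 * e.2.2), r.2 * e.2.2))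
    ([], 1)

/-- Add a weighted state to a table. -/
def insertState (e : State × ℕ) : List (State × ℕ) → List (State × ℕ)
  | [] => [e]
  | a :: t => if a.1 = e.1 then (a.1, a.2 + e.2) :: t else a :: insertState e t

/-- Merge equal states. -/
def merge (l : List (State × ℕ)) : List (State × ℕ) := l.foldr insertState []

/-- The table and the common denominator after one more column. -/
def columnStep (upd : State → State → State) (c : Column) (t : List (State × ℕ) × ℕ) :
    List (State × ℕ) × ℕ :=
  (merge ((common c.2.2).1.flatMap fun v => t.1.map fun s =>
    (upd (c.1.mul v.1, c.2.1.mul v.1) s.1, v.2 * s.2)), (common c.2.2).2 * t.2)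

/-- The distribution of the state after all columns: a table of numerators, and a common
denominator. -/
def table (upd : State → State → State) (base : State) (l : List Column) :
    List (State × ℕ) × ℕ :=
  l.foldr (columnStep upd) ([(base, 1)], 1)

/-- The total weight of the states with a given property. -/
def weight (acc : State → Bool) (t : List (State × ℕ)) : ℕ :=
  t.foldr (fun e r => (bif acc e.1 then e.2 else 0) + r) 0

/-- The columns of an input string. -/
def columns (dec : Raw → Ratio) (l : List Symbol) : List Column :=
  (parse l).map fun c => (dec c.headI, dec c.tail.headI,
    (pairUp c.tail.tail).map fun e => (dec e.1, decodeProb e.2))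

/-- The output string for a nonnegative fraction. -/
def printFraction (a b : ℕ) : List Symbol :=
  Symbol.bit false :: (Computability.encodeNat a).map Symbol.bit ++
    Symbol.slash :: Symbol.bit false :: (Computability.encodeNat b).map Symbol.bit

/-- The whole algorithm. -/
def solve (dec : Raw → Ratio) (upd : State → State → State) (base : State) (acc : State → Bool)
    (l : List Symbol) : List Symbol :=
  printFraction (weight acc (table upd base (columns dec l)).1)
    (table upd base (columns dec l)).2

/-! #### Sizes -/

/-- The common denominator is the plain product of all denominators, so bit lengths add up. The
summand 2 accounts for the denominator 1 of the empty list. -/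
theorem common_spec (l : List (Ratio × ℕ × ℕ)) :
    sz (common l).2 ≤ sz l + 2 ∧ (common l).1.length = l.length ∧
      ∀ v ∈ (common l).1, sz v.1 ≤ sz l ∧ sz v.2 ≤ sz l + 2 := by
  induction l with
  | nil => simp [common, sz_nat]
  | cons e l ih =>
    obtain ⟨h₁, h₂, h₃⟩ := ih
    have he := sz_prod e
    have he' := sz_prod e.2
    simp only [common, List.foldr_cons] at *
    refine ⟨?_, ?_, ?_⟩
    · have := sz_mul_le (List.foldr (fun e r => ((e.1, e.2.1 * r.2) ::
        r.1.map fun v => (v.1, v.2 * e.2.2), r.2 * e.2.2)) ([], 1) l).2 e.2.2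
      rw [sz_cons]; omega
    · simpa using h₂
    · intro v hv
      rw [sz_cons]
      simp only [List.mem_cons, List.mem_map] at hv
      rcases hv with rfl | ⟨w, hw, rfl⟩
      · have := sz_mul_le e.2.1 (List.foldr (fun e r => ((e.1, e.2.1 * r.2) ::
          r.1.map fun v => (v.1, v.2 * e.2.2), r.2 * e.2.2)) ([], 1) l).2
        simp only
        omega
      · have := h₃ w hw
        have := sz_mul_le w.2 e.2.2
        simp only
        omega

theorem sz_common_le (l : List (Ratio × ℕ × ℕ)) :
    sz (common l) ≤ sz l * (2 * sz l + 4) + sz l + 4 := by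
  obtain ⟨h₁, h₂, h₃⟩ := common_spec l
  have h₄ : sz (common l).1 ≤ (common l).1.length * (2 * sz l + 3 + 1) + 1 :=
    sz_list_le fun v hv => by
      have := h₃ v hv
      rw [sz_prod]
      omega
  have h₅ : (common l).1.length * (2 * sz l + 3 + 1) ≤ sz l * (2 * sz l + 4) := by
    rw [h₂]
    gcongr
    exact (length_lt_sz l).le
  rw [sz_prod]
  omega

/-- Adding two weights takes no more room than storing both, by `sz_add_le`; hence merging never
enlarges a table. -/
theorem sz_insertState_le (e : State × ℕ) (t : List (State × ℕ)) :
    sz (insertState e t) ≤ sz e + sz t + 1 := by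
  induction t with
  | nil => simp [insertState]
  | cons a t ih =>
    unfold insertState
    split_ifs with h
    · have := sz_add_le a.2 e.2
      have := sz_prod a
      have := sz_prod e
      simp only [sz_cons, sz_prod (a.1, a.2 + e.2)]
      omega
    · simp only [sz_cons]; omega

theorem sz_merge_le (l : List (State × ℕ)) : sz (merge l) ≤ sz l := by
  induction l with
  | nil => simp [merge]
  | cons e l ih =>
    have := sz_insertState_le e (merge l)
    simp only [merge, List.foldr_cons, sz_cons] at *
    omega

theorem sz_weight_le (acc : State → Bool) (t : List (State × ℕ)) : sz (weight acc t) ≤ sz t := by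
  induction t with
  | nil => simp [weight, sz_nat]
  | cons e t ih =>
    have h := sz_add_le (bif acc e.1 then e.2 else 0) (weight acc t)
    have he := sz_prod e
    have h' : sz (bif acc e.1 then e.2 else 0) ≤ sz e.2 := by
      cases acc e.1 <;> simp [sz_nat]
    simp only [weight, List.foldr_cons, sz_cons] at *
    omega

/-! #### Polynomial time of the parts -/

section

variable {α γ : Type} [Coded α] [Coded γ]

@[fun_prop]
theorem PT.common : PT common := by
  refine PT.foldr (γ := List (Ratio × ℕ × ℕ)) (l := fun l => l) (i := fun _ => ([], 1))
    (f := fun _ (e : Ratio × ℕ × ℕ) (r : List (Ratio × ℕ) × ℕ) =>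
      ((e.1, e.2.1 * r.2) :: r.1.map fun v => (v.1, v.2 * e.2.2), r.2 * e.2.2))
    (by fun_prop) (by fun_prop) ?_
    (B := fun l => sz l * (2 * sz l + 4) + sz l + 4) ?_ ?_
  · refine PT.prodMk (PT.cons (by fun_prop) (PT.map (by fun_prop) (by fun_prop))) (by fun_prop)
  · exact ((PB.size.mul (((PB.const 2).mul PB.size).add (PB.const 4))).add PB.size).add
      (PB.const 4)
  · intro x l' hl'
    refine (sz_common_le l').trans ?_
    have := sz_suffix_le hl'
    gcongr

/-- States are compared as triples, not as rational numbers. Two triples of equal value keep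
separate lines, which affects neither correctness nor the counting of states. -/
theorem PT.decide_eq_state {f g : α → State} (hf : PT f) (hg : PT g) :
    PT fun a => decide (f a = g a) := by
  have : (fun a => decide (f a = g a)) = fun a =>
      (decide ((f a).1.1 = (g a).1.1) && decide ((f a).1.2.1 = (g a).1.2.1) &&
        decide ((f a).1.2.2 = (g a).1.2.2)) &&
      (decide ((f a).2.1 = (g a).2.1) && decide ((f a).2.2.1 = (g a).2.2.1) &&
        decide ((f a).2.2.2 = (g a).2.2.2)) := by
    funext a
    simp only [← Bool.decide_and, decide_eq_decide, Prod.ext_iff]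
    tauto
  rw [this]
  fun_prop

theorem PT.insertState :
    PT fun x : (State × ℕ) × List (State × ℕ) => insertState x.1 x.2 := by
  refine PT.linearRec'
    (c := fun x : (State × ℕ) × List (State × ℕ) =>
      x.2.isEmpty || decide (x.2.headI.1 = x.1.1))
    (n := fun x => (x.1, x.2.tail))
    (g := fun x => bif x.2.isEmpty then [x.1] else
      (x.2.headI.1, x.2.headI.2 + x.1.2) :: x.2.tail)
    (h := fun y => y.1.2.headI :: y.2) ?_ (by fun_prop) (by fun_prop) (by fun_prop) ?_
    (μ := fun x => x.2.length) ?_ ?_ ?_ ?_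
  · exact PT.or (by fun_prop) (PT.decide_eq_state (by fun_prop) (by fun_prop))
  · rintro ⟨e, _ | ⟨a, t⟩⟩
    · rfl
    · by_cases h : a.1 = e.1 <;> simp [PolyTime.insertState, h]
  · rintro ⟨e, _ | ⟨a, t⟩⟩ <;> simp
  · refine PB.size.mono fun x => ?_
    have := length_lt_sz x.2
    rw [sz_prod]; omega
  · rintro ⟨e, _ | ⟨a, t⟩⟩ <;> simp; omega
  · refine PB.size.mono fun x => ?_
    rw [sz_prod]
    exact sz_insertState_le _ _

@[fun_prop]
theorem PT.merge : PT merge := by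
  refine PT.foldr (γ := List (State × ℕ)) (l := fun l => l) (i := fun _ => [])
    (f := fun _ => PolyTime.insertState) (by fun_prop) (by fun_prop) ?_ PB.size ?_
  · exact PT.insertState.comp
      (f := fun p : List (State × ℕ) × (State × ℕ) × List (State × ℕ) => p.2) (by fun_prop)
  · intro x l' hl'
    exact (sz_merge_le l').trans (sz_suffix_le hl')

theorem PT.weight {acc : State → Bool} (h : PT acc) : PT (weight acc) := by
  refine PT.foldr (γ := List (State × ℕ)) (l := fun l => l) (i := fun _ => 0)
    (f := fun _ e r => (bif acc e.1 then e.2 else 0) + r) (by fun_prop) (by fun_prop)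
    (by fun_prop) PB.size ?_
  intro x l' hl'
  exact (sz_weight_le acc l').trans (sz_suffix_le hl')

theorem PT.columns {dec : Raw → Ratio} (h : PT dec) : PT (columns dec) := by
  have := PT.parse
  unfold PolyTime.columns
  fun_prop

theorem PT.printFraction : PT fun p : ℕ × ℕ => printFraction p.1 p.2 := by
  have h₁ : PT Computability.encodeNat := PT.of_enc_eq fun _ => rfl
  have h₂ : PT Symbol.bit := PT.symbolBit (PT.id)
  unfold PolyTime.printFraction
  fun_prop

theorem PT.columnStep {upd : State → State → State} (h : PT fun p : State × State => upd p.1 p.2) :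
    PT fun p : Column × List (State × ℕ) × ℕ => columnStep upd p.1 p.2 := by
  unfold PolyTime.columnStep
  refine PT.prodMk (PT.merge.comp (PT.flatMap (by fun_prop) (PT.map (by fun_prop)
    (PT.prodMk ?_ (by fun_prop))))) (by fun_prop)
  exact h.comp (f := fun p : ((Column × List (State × ℕ) × ℕ) × Ratio × ℕ) × State × ℕ =>
    ((p.1.1.1.1.mul p.1.2.1, p.1.1.1.2.1.mul p.1.2.1), p.2.1)) (by fun_prop)

end

end PolyTime

namespace PolyTime

open Prec Function Coded

/-! #### The size of the table -/

/-- The integral of a function over a table. -/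
def integral (φ : State → ℕ) (t : List (State × ℕ)) : ℕ := (t.map fun e => e.2 * φ e.1).sum

theorem integral_insertState (φ : State → ℕ) (e : State × ℕ) (t : List (State × ℕ)) :
    integral φ (insertState e t) = e.2 * φ e.1 + integral φ t := by
  induction t with
  | nil => simp [insertState, integral]
  | cons a t ih =>
    unfold insertState
    split_ifs with h
    · simp [integral, h]; ring
    · simp only [integral, List.map_cons, List.sum_cons] at *
      rw [ih]; ring

theorem integral_merge (φ : State → ℕ) (l : List (State × ℕ)) :
    integral φ (merge l) = integral φ l := by
  induction l with
  | nil => rfl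
  | cons e l ih =>
    have := integral_insertState φ e (merge l)
    rw [ih] at this
    simpa [merge, integral] using this

/-- Merging is invisible to integrals. The constant `φ = 1` later bounds the weights, and an
indicator `φ` yields the probability. -/
theorem integral_columnStep (φ : State → ℕ) (upd : State → State → State) (c : Column)
    (t : List (State × ℕ) × ℕ) :
    integral φ (columnStep upd c t).1 = ((common c.2.2).1.map fun v =>
      v.2 * integral (fun s => φ (upd (c.1.mul v.1, c.2.1.mul v.1) s)) t.1).sum := by
  rw [columnStep, integral_merge]
  induction (common c.2.2).1 with
  | nil => rfl
  | cons v l ih =>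
    simp only [integral, List.flatMap_cons, List.map_append, List.sum_append, List.map_cons,
      List.sum_cons] at *
    rw [ih, ← List.sum_map_mul_left]
    simp [Function.comp_def, mul_assoc]

theorem mem_keys_insertState (e : State × ℕ) (t : List (State × ℕ)) (s : State) :
    s ∈ (insertState e t).map Prod.fst ↔ s = e.1 ∨ s ∈ t.map Prod.fst := by
  induction t with
  | nil => simp [insertState]
  | cons a t ih =>
    unfold insertState
    split_ifs with h
    · rw [← h]; simp
    · rw [List.map_cons, List.mem_cons, ih, List.map_cons, List.mem_cons]; tauto

theorem nodup_keys_insertState (e : State × ℕ) (t : List (State × ℕ))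
    (h : (t.map Prod.fst).Nodup) : ((insertState e t).map Prod.fst).Nodup := by
  induction t with
  | nil => simp [insertState]
  | cons a t ih =>
    rw [List.map_cons, List.nodup_cons] at h
    unfold insertState
    split_ifs with ha
    · simpa using h
    · rw [List.map_cons, List.nodup_cons, mem_keys_insertState]
      exact ⟨by rintro (h' | h'); exacts [ha h', h.1 h'], ih h.2⟩

theorem nodup_keys_merge (l : List (State × ℕ)) : ((merge l).map Prod.fst).Nodup := by
  induction l with
  | nil => simp [merge]
  | cons e l ih => exact nodup_keys_insertState e _ ih

theorem mem_keys_merge (l : List (State × ℕ)) (s : State) :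
    s ∈ (merge l).map Prod.fst ↔ s ∈ l.map Prod.fst := by
  induction l with
  | nil => rfl
  | cons e l ih =>
    rw [List.map_cons, List.mem_cons, ← ih]
    exact mem_keys_insertState e _ s

theorem nodup_keys_table (upd : State → State → State) (base : State) (l : List Column) :
    ((table upd base l).1.map Prod.fst).Nodup := by
  cases l with
  | nil => simp [table]
  | cons c l => exact nodup_keys_merge _

theorem keys_common (l : List (Ratio × ℕ × ℕ)) :
    (common l).1.map Prod.fst = l.map Prod.fst := by
  induction l with
  | nil => rfl
  | cons e l ih =>
    simp only [common, List.foldr_cons, List.map_cons, List.map_map] at *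
    rw [← ih]
    rfl

/-- Bounding the number of lines is reduced to exhibiting finite sets `K n` that contain the states
reachable after `n` columns. -/
theorem keys_table {upd : State → State → State} {base : State} {l : List Column}
    {K : ℕ → Finset State} (hbase : base ∈ K 0)
    (hstep : ∀ c ∈ l, ∀ v ∈ c.2.2, ∀ n, ∀ s ∈ K n,
      upd (c.1.mul v.1, c.2.1.mul v.1) s ∈ K (n + 1)) :
    ∀ s ∈ (table upd base l).1.map Prod.fst, s ∈ K l.length := by
  induction l with
  | nil => simpa [table] using hbase
  | cons c l ih =>
    intro s hs
    have ih := ih fun d hd => hstep d (by simp [hd])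
    have hs := (mem_keys_merge _ s).1 hs
    simp only [List.mem_map, List.mem_flatMap] at hs
    obtain ⟨_, ⟨v, hv, e, he, rfl⟩, rfl⟩ := hs
    have hv' : v.1 ∈ c.2.2.map Prod.fst := by
      rw [← keys_common]; exact List.mem_map_of_mem hv
    obtain ⟨w, hw, hwv⟩ := List.mem_map.1 hv'
    simp only
    rw [← hwv]
    exact hstep c (by simp) w hw _ _ (ih _ (List.mem_map_of_mem he))

theorem sz_sum_le (l : List (Ratio × ℕ)) : sz (l.map Prod.snd).sum ≤ sz l := by
  induction l with
  | nil => simp [sz_nat]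
  | cons e l ih =>
    have h := sz_add_le e.2 (l.map Prod.snd).sum
    have he := sz_prod e
    simp only [List.map_cons, List.sum_cons, sz_cons]
    omega

/-- A bound for the growth of the weights in one column. -/
def growth (n : ℕ) : ℕ := n * (2 * n + 4) + n + 4

/-- Whatever the update, a column multiplies the total weight by the sum of its numerators and the
denominator by its common denominator, so bit lengths grow additively. The 3 is the size of the
number 1. -/
theorem sz_total_le (upd : State → State → State) (base : State) {l : List Column} {n : ℕ}
    (hn : ∀ c ∈ l, sz c ≤ n) :
    sz (integral (fun _ => 1) (table upd base l).1) ≤ l.length * growth n + 3 ∧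
      sz (table upd base l).2 ≤ l.length * growth n + 3 := by
  induction l with
  | nil => simp [table, integral, sz_nat]
  | cons c l ih =>
    obtain ⟨h₁, h₂⟩ := ih fun d hd => hn d (by simp [hd])
    have hc : sz (common c.2.2) ≤ growth n := by
      have h₃ : sz c.2.2 ≤ n := by
        have := hn c (by simp)
        have := sz_prod c
        have := sz_prod c.2
        omega
      refine (sz_common_le c.2.2).trans ?_
      unfold growth
      gcongr
    have hc' := sz_prod (common c.2.2)
    have e : (table upd base (c :: l)) = columnStep upd c (table upd base l) := rfl
    rw [e, integral_columnStep, List.length_cons, add_mul, one_mul]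
    constructor
    · rw [List.sum_map_mul_right]
      have h₃ := sz_sum_le (common c.2.2).1
      have h₄ := sz_mul_le ((common c.2.2).1.map Prod.snd).sum
        (integral (fun _ => 1) (table upd base l).1)
      exact h₄.trans (by omega)
    · have h₄ := sz_mul_le (common c.2.2).2 (table upd base l).2
      exact h₄.trans (by omega)

/-- The keys are distinct and lie in `K`, which bounds the number of lines; each weight is at most
the total weight, which bounds their lengths. -/
theorem sz_table_le {upd : State → State → State} {base : State} {l : List Column} {K : Finset State}
    {b n : ℕ} (hn : sz l ≤ n) (hK : ∀ s ∈ (table upd base l).1.map Prod.fst, s ∈ K)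
    (hcard : K.card ≤ b) (hb : ∀ s ∈ K, sz s ≤ b) :
    sz (table upd base l) ≤ b * (b + (n * growth n + 3) + 2) + (n * growth n + 3) + 2 := by
  have hc : ∀ c ∈ l, sz c ≤ n := fun c hc => ((sz_lt_of_mem hc).le).trans hn
  obtain ⟨h₁, h₂⟩ := sz_total_le upd base hc
  have hl : l.length * growth n ≤ n * growth n := by
    gcongr
    exact (length_lt_sz l).le.trans hn
  have hlen : (table upd base l).1.length ≤ b := by
    rw [← List.length_map Prod.fst, ← List.toFinset_card_of_nodup (nodup_keys_table upd base l)]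
    exact (Finset.card_le_card fun s hs => hK s (List.mem_toFinset.1 hs)).trans hcard
  have h₃ : sz (table upd base l).1 ≤
      (table upd base l).1.length * (b + (n * growth n + 3) + 1 + 1) + 1 := by
    refine sz_list_le fun e he => ?_
    have h₄ := hb e.1 (hK _ (List.mem_map_of_mem he))
    have h₅ : e.2 ≤ integral (fun _ => 1) (table upd base l).1 := by
      refine List.single_le_sum (fun _ _ => Nat.zero_le _) _ ?_
      exact List.mem_map.2 ⟨e, he, by simp⟩
    have h₆ := sz_mono h₅
    rw [sz_prod]
    omega
  have h₇ : (table upd base l).1.length * (b + (n * growth n + 3) + 1 + 1) ≤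
      b * (b + (n * growth n + 3) + 2) := by gcongr
  rw [sz_prod]
  omega

/-! ### Polynomial time of the algorithm -/

section

variable {γ : Type} [Coded γ]

theorem PT.table [Inhabited γ] {upd : State → State → State} {base : State} {l : γ → List Column}
    (hl : PT l) (hupd : PT fun p : State × State => upd p.1 p.2) {K : γ → ℕ → Finset State}
    {B : γ → ℕ} (hB : PB B) (hbase : ∀ x, base ∈ K x 0)
    (hstep : ∀ x, ∀ c ∈ l x, ∀ v ∈ c.2.2, ∀ n, ∀ s ∈ K x n,
      upd (c.1.mul v.1, c.2.1.mul v.1) s ∈ K x (n + 1))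
    (hcard : ∀ x, ∀ n ≤ (l x).length, (K x n).card ≤ B x)
    (hsz : ∀ x, ∀ n ≤ (l x).length, ∀ s ∈ K x n, sz s ≤ B x) :
    PT fun x => table upd base (l x) := by
  have hg : PB fun x => sz (l x) * growth (sz (l x)) + 3 :=
    (hl.size.mul (((hl.size.mul (((PB.const 2).mul hl.size).add (PB.const 4))).add hl.size).add
      (PB.const 4))).add (PB.const 3)
  refine PT.foldr (f := fun _ => PolyTime.columnStep upd) (i := fun _ => ([(base, 1)], 1)) hl
    (by fun_prop) ?_ (((hB.mul ((hB.add hg).add (PB.const 2))).add hg).add (PB.const 2)) ?_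
  · exact (PT.columnStep hupd).comp
      (f := fun p : γ × Column × List (State × ℕ) × ℕ => p.2) (by fun_prop)
  · intro x l' hl'
    exact sz_table_le (sz_suffix_le hl')
      (keys_table (hbase x) fun c hc => hstep x c (hl'.mem hc))
      (hcard x _ hl'.length_le) (hsz x _ hl'.length_le)

theorem PT.solve {dec : Raw → Ratio} {upd : State → State → State} {base : State}
    {acc : State → Bool} (hacc : PT acc)
    (h : PT fun l => PolyTime.table upd base (PolyTime.columns dec l)) : PT (solve dec upd base acc) := by
  exact PT.printFraction.comp (f := fun l => (PolyTime.weight acc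
    (PolyTime.table upd base (PolyTime.columns dec l)).1,
      (PolyTime.table upd base (PolyTime.columns dec l)).2))
    (((PT.weight hacc).comp h.fst).prodMk h.snd)

/-- The scores that may occur if every score is initial or the product of an entry with a
weight. -/
def scores (base : State) (l : List Column) : List Ratio :=
  base.1 :: base.2 :: l.flatMap fun c => c.2.2.flatMap fun v => [c.1.mul v.1, c.2.1.mul v.1]

/-- Updates that only select among existing scores create no new ones, so a single set, the square
of the list of possible scores, serves for all columns. -/
theorem PT.solve_of_mem {dec : Raw → Ratio} {upd : State → State → State} {base : State}
    {acc : State → Bool} (hdec : PT dec) (hupd : PT fun p : State × State => upd p.1 p.2)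
    (hacc : PT acc)
    (hmem : ∀ x s, ((upd x s).1 = x.1 ∨ (upd x s).1 = s.1) ∧
      ((upd x s).2 = x.2 ∨ (upd x s).2 = s.2)) : PT (PolyTime.solve dec upd base acc) := by
  have hcol := PT.columns hdec
  have hs : PT fun l => scores base (PolyTime.columns dec l) := by
    unfold scores; fun_prop
  have hB := hs.size
  -- If `S` is the size of the score list, there are at most `S * S` states of size at most `2 * S +
  -- 1`; the bound `3 * (S * S) + 1` covers both.
  refine PT.solve hacc (PT.table hcol hupd
    (K := fun l _ => (scores base (PolyTime.columns dec l)).toFinset ×ˢ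
      (scores base (PolyTime.columns dec l)).toFinset)
    (((PB.const 3).mul (hB.mul hB)).add (PB.const 1)) ?_ ?_ ?_ ?_)
  · intro l; simp [scores]
  · intro l c hc v hv _ s hs
    simp only [Finset.mem_product, List.mem_toFinset] at hs ⊢
    have h₁ : c.1.mul v.1 ∈ scores base (PolyTime.columns dec l) := by
      simp only [scores, List.mem_cons, List.mem_flatMap]
      exact .inr (.inr ⟨c, hc, v, hv, by simp⟩)
    have h₂ : c.2.1.mul v.1 ∈ scores base (PolyTime.columns dec l) := by
      simp only [scores, List.mem_cons, List.mem_flatMap]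
      exact .inr (.inr ⟨c, hc, v, hv, by simp⟩)
    obtain ⟨h₃, h₄⟩ := hmem (c.1.mul v.1, c.2.1.mul v.1) s
    constructor
    · rcases h₃ with h | h <;> rw [h]
      exacts [h₁, hs.1]
    · rcases h₄ with h | h <;> rw [h]
      exacts [h₂, hs.2]
  · intro l n _
    rw [Finset.card_product]
    have h : (scores base (PolyTime.columns dec l)).toFinset.card ≤
        sz (scores base (PolyTime.columns dec l)) :=
      (List.toFinset_card_le _).trans (length_lt_sz _).le
    have := Nat.mul_le_mul h h
    omega
  · intro l n _ s hs
    simp only [Finset.mem_product, List.mem_toFinset] at hs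
    have h₁ := sz_lt_of_mem hs.1
    have h₂ := sz_lt_of_mem hs.2
    rw [sz_prod]
    nlinarith

/-- The only use of the unary encoding: a number is bounded by the length of its string, not merely
by an exponential of it. -/
theorem decodeUnary_le (r : Raw) : (decodeUnary r).1 ≤ sz r ∧ (decodeUnary r).2.1 ≤ sz r ∧
    (decodeUnary r).2.2 = 1 := by
  have h : r.headI.tail.length ≤ sz r := by
    rcases r with _ | ⟨_ | ⟨b, l⟩, r⟩
    · exact Nat.zero_le _
    · exact Nat.zero_le _
    · have := length_lt_sz l
      rw [sz_cons, sz_cons]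
      change l.length ≤ _
      omega
  unfold decodeUnary
  cases r.headI.headI
  exacts [⟨h, Nat.zero_le _, rfl⟩, ⟨Nat.zero_le _, h, rfl⟩]

theorem sz_headI_le (c : List Raw) : sz c.headI ≤ sz c := by
  cases c with
  | nil => exact le_rfl
  | cons a c => simp; omega

theorem sz_tail_le (c : List Raw) : sz c.tail ≤ sz c := sz_suffix_le (List.tail_suffix c)

theorem mul_le_of_le {x y : Ratio} {n : ℕ} (hx : x.1 ≤ n ∧ x.2.1 ≤ n ∧ x.2.2 = 1)
    (hy : y.1 ≤ n ∧ y.2.1 ≤ n ∧ y.2.2 = 1) : (x.mul y).1 ≤ 2 * (n * n) ∧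
      (x.mul y).2.1 ≤ 2 * (n * n) ∧ (x.mul y).2.2 = 1 := by
  have h₁ := Nat.mul_le_mul hx.1 hy.1
  have h₂ := Nat.mul_le_mul hx.1 hy.2.1
  have h₃ := Nat.mul_le_mul hx.2.1 hy.1
  have h₄ := Nat.mul_le_mul hx.2.1 hy.2.1
  refine ⟨?_, ?_, ?_⟩
  · change x.1 * y.1 + x.2.1 * y.2.1 ≤ _; omega
  · change x.1 * y.2.1 + x.2.1 * y.1 ≤ _; omega
  · change x.2.2 * y.2.2 = 1; rw [hx.2.2, hy.2.2]

theorem columns_unary_le {l : List Symbol} {c : Column} (hc : c ∈ columns decodeUnary l)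
    {v : Ratio × ℕ × ℕ} (hv : v ∈ c.2.2) :
    ((c.1.mul v.1).1 ≤ 2 * (sz (parse l) * sz (parse l)) ∧
      (c.1.mul v.1).2.1 ≤ 2 * (sz (parse l) * sz (parse l)) ∧ (c.1.mul v.1).2.2 = 1) ∧
    ((c.2.1.mul v.1).1 ≤ 2 * (sz (parse l) * sz (parse l)) ∧
      (c.2.1.mul v.1).2.1 ≤ 2 * (sz (parse l) * sz (parse l)) ∧ (c.2.1.mul v.1).2.2 = 1) := by
  have hd : ∀ {r : Raw}, sz r ≤ sz (parse l) → (decodeUnary r).1 ≤ sz (parse l) ∧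
      (decodeUnary r).2.1 ≤ sz (parse l) ∧ (decodeUnary r).2.2 = 1 := fun {r} h => by
    have := decodeUnary_le r
    omega
  obtain ⟨c, hc', rfl⟩ := List.mem_map.1 hc
  obtain ⟨e, he, rfl⟩ := List.mem_map.1 hv
  have h₁ := (sz_lt_of_mem hc').le
  have h₂ := sz_headI_le c.tail
  have h₃ := sz_tail_le c
  have h₄ := sz_tail_le c.tail
  have h₅ := sz_pairUp_le c.tail.tail
  have h₆ := sz_lt_of_mem he
  have h₇ := sz_prod e
  have h₈ := sz_headI_le c
  have hv := hd (r := e.1) (by omega)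
  exact ⟨mul_le_of_le (hd (by omega)) hv, mul_le_of_le (hd (by omega)) hv⟩

/-- Pairs of integers that are differences of numbers up to `n`. -/
def integerStates (n : ℕ) : Finset State :=
  ((Finset.range (n + 1) ×ˢ Finset.range (n + 1)) ×ˢ
    (Finset.range (n + 1) ×ˢ Finset.range (n + 1))).image
      fun p => ((p.1.1, p.1.2, 1), (p.2.1, p.2.2, 1))

theorem mem_integerStates {n : ℕ} {s : State} : s ∈ integerStates n ↔
    (s.1.1 ≤ n ∧ s.1.2.1 ≤ n ∧ s.1.2.2 = 1) ∧ s.2.1 ≤ n ∧ s.2.2.1 ≤ n ∧ s.2.2.2 = 1 := by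
  obtain ⟨⟨a, b, c⟩, d, e, f⟩ := s
  simp only [integerStates, Finset.mem_image, Finset.mem_product, Finset.mem_range, Prod.exists,
    Prod.mk.injEq, Nat.lt_succ_iff]
  constructor
  · rintro ⟨a, b, d, e, h, ⟨rfl, rfl, rfl⟩, rfl, rfl, rfl⟩
    tauto
  · rintro ⟨⟨h₁, h₂, rfl⟩, h₃, h₄, rfl⟩
    exact ⟨a, b, d, e, by tauto, by tauto⟩

theorem card_integerStates_le (n : ℕ) :
    (integerStates n).card ≤ ((n + 1) * (n + 1)) * ((n + 1) * (n + 1)) := by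
  refine Finset.card_image_le.trans ?_
  simp [Finset.card_product]

theorem sz_le_of_mem_integerStates {n : ℕ} {s : State} (h : s ∈ integerStates n) :
    sz s ≤ 8 * n + 15 := by
  obtain ⟨⟨h₁, h₂, h₃⟩, h₄, h₅, h₆⟩ := mem_integerStates.1 h
  have i₁ := sz_nat_le s.1.1
  have i₂ := sz_nat_le s.1.2.1
  have i₃ := sz_nat_le s.1.2.2
  have i₄ := sz_nat_le s.2.1
  have i₅ := sz_nat_le s.2.2.1
  have i₆ := sz_nat_le s.2.2.2
  simp only [sz_prod]
  omega

/-- Addition of scores. -/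
def addScores (x s : State) : State := (s.1.add x.1, s.2.add x.2)

/-- The state with both scores zero. -/
def zeroScores : State := ((0, 0, 1), (0, 0, 1))

/-- Positive and negative parts are accumulated separately over the denominator 1. With `N` the size
of the parsed input, a product has parts at most `2 * (N * N)`, so after `n` columns each part is at
most `n` times this. The number of states is a fourth power of such a bound. -/
theorem PT.solve_addScores {acc : State → Bool} (hacc : PT acc) :
    PT (PolyTime.solve PolyTime.decodeUnary addScores zeroScores acc) := by
  have hN := PT.parse.size
  have hM := (hN.mul ((PB.const 2).mul (hN.mul hN))).add (PB.const 1)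
  refine PT.solve hacc (PT.table (PT.columns PT.decodeUnary) (by unfold addScores; fun_prop)
    (K := fun l n => integerStates (n * (2 * (sz (PolyTime.parse l) * sz (PolyTime.parse l)))))
    (((hM.mul hM).mul (hM.mul hM)).add (((PB.const 8).mul hM).add (PB.const 15))) ?_ ?_ ?_ ?_)
  · intro l; simp [mem_integerStates, zeroScores]
  · intro l c hc v hv n s hs
    have h := columns_unary_le hc hv
    rw [mem_integerStates] at hs ⊢
    obtain ⟨⟨h₁, h₂, h₃⟩, h₄, h₅, h₆⟩ := h
    obtain ⟨⟨i₁, i₂, i₃⟩, i₄, i₅, i₆⟩ := hs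
    simp only [addScores, Ratio.add, h₃, h₆, i₃, i₆, mul_one, and_true, add_mul n 1, one_mul]
    omega
  · intro l n hn
    have hn : n * (2 * (sz (PolyTime.parse l) * sz (PolyTime.parse l))) + 1 ≤
        sz (PolyTime.parse l) * (2 * (sz (PolyTime.parse l) * sz (PolyTime.parse l))) + 1 := by
      gcongr
      have := length_lt_sz (PolyTime.parse l)
      simp only [PolyTime.columns, List.length_map] at hn
      omega
    refine (card_integerStates_le _).trans (le_add_right ?_)
    gcongr
  · intro l n hn s hs
    have hn : n * (2 * (sz (PolyTime.parse l) * sz (PolyTime.parse l))) ≤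
        sz (PolyTime.parse l) * (2 * (sz (PolyTime.parse l) * sz (PolyTime.parse l))) := by
      gcongr
      have := length_lt_sz (PolyTime.parse l)
      simp only [PolyTime.columns, List.length_map] at hn
      omega
    have := sz_le_of_mem_integerStates hs
    omega

end

end PolyTime

namespace PolyTime

open Prec Function Coded

/-! ### Correctness of parsing and decoding -/

/-- Parsing runs from right to left, so what lies to the right has already opened the part that
receives the digits. -/
theorem parse_bits (l : List Bool) {s : List Symbol} {p : List Bool} {ps : Raw} {nums : List Raw}
    {cols : List (List Raw)} (h : parse s = ((p :: ps) :: nums) :: cols) :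
    parse (l.map Symbol.bit ++ s) = (((l ++ p) :: ps) :: nums) :: cols := by
  induction l with
  | nil => exact h
  | cons b l ih =>
    change parseStep (.bit b) (parse (l.map Symbol.bit ++ s)) = _
    rw [ih]
    rfl

theorem parse_slash {s : List Symbol} {ps : Raw} {nums : List Raw} {cols : List (List Raw)}
    (h : parse s = (ps :: nums) :: cols) : parse (.slash :: s) = (([] :: ps) :: nums) :: cols := by
  change parseStep .slash (parse s) = _
  rw [h]
  rfl

theorem parse_comma {s : List Symbol} {nums : List Raw} {cols : List (List Raw)}
    (h : parse s = nums :: cols) : parse (.comma :: s) = ([[]] :: nums) :: cols := by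
  change parseStep .comma (parse s) = _
  rw [h]
  rfl

namespace Ratio

/-- The number that a ratio stands for. -/
def val (x : Ratio) : ℚ := ((x.1 : ℚ) - x.2.1) / x.2.2

end Ratio

/-- A correct way to read numbers of format `V`: `raw v` lists the parts of the string that
represents `v`, and `dec` computes the value from them. -/
structure Reads (V : Type) [NumberFormat V] (raw : V → Raw) (dec : Raw → Ratio) : Prop where
  parse_eq : ∀ v s nums cols, parse s = nums :: cols →
    parse (NumberFormat.encode v ++ .comma :: s) = (raw v :: nums) :: cols
  pos : ∀ v, 0 < (dec (raw v)).2.2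
  val_eq : ∀ v, (dec (raw v)).val = NumberFormat.toRat v

/-- The parts of a fraction. -/
def rawFraction (q : Fraction) : Raw :=
  [decide (q.num < 0) :: Computability.encodeNat q.num.natAbs,
    decide (q.den < 0) :: Computability.encodeNat q.den.natAbs]

/-- The single part of a unary integer. -/
def rawUnary (a : UnaryInt) : Raw :=
  [decide (a.toInt < 0) :: List.replicate a.toInt.natAbs true]

theorem reads_fraction : Reads Fraction rawFraction decodeFraction where
  parse_eq v s nums cols h := by
    have h₁ := parse_bits (decide (v.den < 0) :: Computability.encodeNat v.den.natAbs)
      (parse_comma h)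
    have h₂ := parse_bits (decide (v.num < 0) :: Computability.encodeNat v.num.natAbs)
      (parse_slash h₁)
    simpa [NumberFormat.encode, encodeBinaryInt, rawFraction] using h₂
  pos v := by
    have : 0 < v.den.natAbs := Int.natAbs_pos.2 v.den_ne_zero
    have hd : (decodeFraction (rawFraction v)).2.2 = v.den.natAbs := by
      unfold decodeFraction
      cases Bool.xor (rawFraction v).headI.headI (rawFraction v).tail.headI.headI <;>
        exact natOfBits_encodeNat _
    omega
  val_eq v := by
    have e : decodeFraction (rawFraction v) =
        bif Bool.xor (decide (v.num < 0)) (decide (v.den < 0)) then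
          (0, v.num.natAbs, v.den.natAbs) else (v.num.natAbs, 0, v.den.natAbs) := by
      simp [decodeFraction, rawFraction, natOfBits_encodeNat]
    rw [e]
    have h₁ : ((v.num.natAbs : ℕ) : ℚ) = |(v.num : ℚ)| := by simp [Nat.cast_natAbs]
    have h₂ : ((v.den.natAbs : ℕ) : ℚ) = |(v.den : ℚ)| := by simp [Nat.cast_natAbs]
    change _ = (v.num : ℚ) / (v.den : ℚ)
    rcases lt_or_ge v.num 0 with hn | hn <;> rcases lt_or_ge v.den 0 with hd | hd
    · have hn' : (v.num : ℚ) < 0 := by exact_mod_cast hn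
      have hd' : (v.den : ℚ) < 0 := by exact_mod_cast hd
      simp [hn, hd, Ratio.val, h₁, h₂, abs_of_neg hn', abs_of_neg hd', -Nat.cast_natAbs]
    · have hn' : (v.num : ℚ) < 0 := by exact_mod_cast hn
      have hd' : 0 ≤ (v.den : ℚ) := by exact_mod_cast hd
      simp [hn, hd.not_gt, Ratio.val, h₁, h₂, abs_of_neg hn', abs_of_nonneg hd',
        -Nat.cast_natAbs]
    · have hn' : 0 ≤ (v.num : ℚ) := by exact_mod_cast hn
      have hd' : (v.den : ℚ) < 0 := by exact_mod_cast hd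
      simp [hn.not_gt, hd, Ratio.val, h₁, h₂, abs_of_nonneg hn', abs_of_neg hd',
        -Nat.cast_natAbs]
    · have hn' : 0 ≤ (v.num : ℚ) := by exact_mod_cast hn
      have hd' : 0 ≤ (v.den : ℚ) := by exact_mod_cast hd
      simp [hn.not_gt, hd.not_gt, Ratio.val, h₁, h₂, abs_of_nonneg hn', abs_of_nonneg hd',
        -Nat.cast_natAbs]

theorem decodeProb_rawFraction (q : Fraction) :
    decodeProb (rawFraction q) = (q.num.natAbs, q.den.natAbs) := by
  simp [decodeProb, rawFraction, natOfBits_encodeNat]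

theorem reads_unary : Reads UnaryInt rawUnary decodeUnary where
  parse_eq v s nums cols h := by
    have h₁ := parse_bits (decide (v.toInt < 0) :: List.replicate v.toInt.natAbs true)
      (parse_comma h)
    simpa [NumberFormat.encode, encodeUnaryInt, rawUnary] using h₁
  pos v := by
    rw [(decodeUnary_le _).2.2]
    exact one_pos
  val_eq v := by
    have h₁ : ((v.toInt.natAbs : ℕ) : ℚ) = |(v.toInt : ℚ)| := by simp [Nat.cast_natAbs]
    change _ = (v.toInt : ℚ)
    rcases lt_or_ge v.toInt 0 with hn | hn
    · have hn' : (v.toInt : ℚ) < 0 := by exact_mod_cast hn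
      simp [decodeUnary, rawUnary, hn, Ratio.val, h₁, abs_of_neg hn', -Nat.cast_natAbs]
    · have hn' : 0 ≤ (v.toInt : ℚ) := by exact_mod_cast hn
      simp [decodeUnary, rawUnary, hn.not_gt, Ratio.val, h₁, abs_of_nonneg hn',
        -Nat.cast_natAbs]

section

variable {V : Type} [NumberFormat V] {raw : V → Raw} {dec : Raw → Ratio}

theorem parse_pairs (h : Reads V raw dec) (l : List (V × Fraction)) {s : List Symbol}
    {nums : List Raw} {cols : List (List Raw)} (hs : parse s = nums :: cols) :
    parse ((l.flatMap fun e => NumberFormat.encode e.1 ++ Symbol.comma ::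
      (NumberFormat.encode e.2 ++ [Symbol.comma])) ++ s) =
      ((l.flatMap fun e => [raw e.1, rawFraction e.2]) ++ nums) :: cols := by
  induction l with
  | nil => exact hs
  | cons e l ih =>
    have h₁ := h.parse_eq e.1 _ _ _ (reads_fraction.parse_eq e.2 _ _ _ ih)
    simpa using h₁

/-- The decoded columns of an input. -/
def decodedColumn (raw : V → Raw) (dec : Raw → Ratio) (a b : V) (d : FiniteDist V) : Column :=
  (dec (raw a), dec (raw b), d.pairs.map fun e => (dec (raw e.1), e.2.num.natAbs, e.2.den.natAbs))

theorem pairUp_flatMap {α β : Type} (l : List α) (f g : α → β) :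
    pairUp (l.flatMap fun e => [f e, g e]) = l.map fun e => (f e, g e) := by
  induction l with
  | nil => rfl
  | cons e l ih => simp [pairUp, ih]

theorem columns_encode (h : Reads V raw dec) (x : Input V) :
    columns dec x.encode =
      List.ofFn fun j => decodedColumn raw dec (x.matrix 0 j) (x.matrix 1 j) (x.dist j) := by
  -- Arbitrary lists of column indices, so that induction does not change the number of columns of
  -- `x`.
  have hp : ∀ l : List (Fin x.cols), parse (l.map x.encodeColumn).flatten =
      l.map fun j => raw (x.matrix 0 j) :: raw (x.matrix 1 j) ::
        ((x.dist j).pairs.flatMap fun e => [raw e.1, rawFraction e.2]) := by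
    intro l
    induction l with
    | nil => rfl
    | cons j l ih =>
      have h₀ : parse (Symbol.semicolon :: (l.map x.encodeColumn).flatten) =
          [] :: parse (l.map x.encodeColumn).flatten := rfl
      rw [ih] at h₀
      have h₁ := h.parse_eq (x.matrix 0 j) _ _ _ (h.parse_eq (x.matrix 1 j) _ _ _
        (parse_pairs h (x.dist j).pairs h₀))
      simpa [Input.encodeColumn] using h₁
  have hx : x.encode = ((List.finRange x.cols).map x.encodeColumn).flatten := by
    rw [Input.encode, List.ofFn_eq_map]
  rw [columns, hx, hp, List.ofFn_eq_map, List.map_map]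
  refine List.map_congr_left fun j _ => ?_
  simp [decodedColumn, pairUp_flatMap, decodeProb_rawFraction]

end

end PolyTime

namespace PolyTime

open Prec Function Coded

/-! ### Correctness of the table -/

theorem common_snd (l : List (Ratio × ℕ × ℕ)) (hl : ∀ v ∈ l, v.2.2 ≠ 0) : (common l).2 ≠ 0 := by
  induction l with
  | nil => simp [common]
  | cons e l ih =>
    have h := ih fun v hv => hl v (by simp [hv])
    simp only [common, List.foldr_cons] at *
    exact mul_ne_zero h (hl e (by simp))

theorem sum_common (l : List (Ratio × ℕ × ℕ)) (hl : ∀ v ∈ l, v.2.2 ≠ 0) (ψ : Ratio → ℚ) :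
    ((common l).1.map fun v => (v.2 : ℚ) * ψ v.1).sum =
      (common l).2 * (l.map fun v => (v.2.1 : ℚ) / v.2.2 * ψ v.1).sum := by
  induction l with
  | nil => simp [common]
  | cons e l ih =>
    have h := ih fun v hv => hl v (by simp [hv])
    have he : (e.2.2 : ℚ) ≠ 0 := by exact_mod_cast hl e (by simp)
    simp only [common, List.foldr_cons, List.map_cons, List.sum_cons, List.map_map] at *
    have : ∀ k : List (Ratio × ℕ), (k.map ((fun v : Ratio × ℕ => (v.2 : ℚ) * ψ v.1) ∘
        fun v => (v.1, v.2 * e.2.2))).sum = e.2.2 * (k.map fun v => (v.2 : ℚ) * ψ v.1).sum := by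
      intro k
      rw [← List.sum_map_mul_left]
      congr 1
      refine List.map_congr_left fun v _ => ?_
      simp only [comp_apply, Nat.cast_mul]
      ring
    rw [this, h]
    push_cast
    field_simp

/-- The expected value of `φ` at the final state. -/
def expect (upd : State → State → State) (base : State) : (State → ℕ) → List Column → ℚ
  | φ, [] => φ base
  | φ, c :: l => (c.2.2.map fun v => (v.2.1 : ℚ) / v.2.2 *
      expect upd base (fun s => φ (upd (c.1.mul v.1, c.2.1.mul v.1) s)) l).sum

theorem table_snd (upd : State → State → State) (base : State) (l : List Column)
    (hl : ∀ c ∈ l, ∀ v ∈ c.2.2, v.2.2 ≠ 0) : (table upd base l).2 ≠ 0 := by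
  induction l with
  | nil => simp [table]
  | cons c l ih =>
    exact mul_ne_zero (common_snd _ (hl c (by simp))) (ih fun d hd => hl d (by simp [hd]))

/-- The induction is over all `φ` at once, because peeling off a column composes `φ` with the update
by that column. -/
theorem integral_table (upd : State → State → State) (base : State) (φ : State → ℕ)
    (l : List Column) (hl : ∀ c ∈ l, ∀ v ∈ c.2.2, v.2.2 ≠ 0) :
    (integral φ (table upd base l).1 : ℚ) = (table upd base l).2 * expect upd base φ l := by
  induction l generalizing φ with
  | nil => simp [table, integral, expect]
  | cons c l ih =>
    have ih := fun φ => ih φ fun d hd => hl d (by simp [hd])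
    have e : table upd base (c :: l) = columnStep upd c (table upd base l) := rfl
    rw [e, integral_columnStep, expect, Nat.cast_list_sum, List.map_map]
    have := sum_common c.2.2 (hl c (by simp)) fun v => (table upd base l).2 *
      expect upd base (fun s => φ (upd (c.1.mul v, c.2.1.mul v) s)) l
    have h₁ : ∀ v : Ratio × ℕ, ((Nat.cast : ℕ → ℚ) ∘ fun v : Ratio × ℕ => v.2 *
        integral (fun s => φ (upd (c.1.mul v.1, c.2.1.mul v.1) s)) (table upd base l).1) v =
        (v.2 : ℚ) * ((table upd base l).2 *
          expect upd base (fun s => φ (upd (c.1.mul v.1, c.2.1.mul v.1) s)) l) := by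
      intro v
      simp only [comp_apply, Nat.cast_mul, ih]
    rw [List.map_congr_left fun v _ => h₁ v, this]
    simp only [columnStep, Nat.cast_mul, mul_assoc]
    congr 1
    rw [← List.sum_map_mul_left]
    congr 1
    refine List.map_congr_left fun v _ => ?_
    ring

theorem weight_eq_integral (acc : State → Bool) (t : List (State × ℕ)) :
    weight acc t = integral (fun s => bif acc s then 1 else 0) t := by
  induction t with
  | nil => rfl
  | cons e t ih =>
    simp only [weight, integral, List.foldr_cons, List.map_cons, List.sum_cons] at *
    rw [ih]
    cases acc e.1 <;> simp

/-! ### The probability as an expected value -/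

section

variable {V : Type} [NumberFormat V]

/-- The algorithm runs over listed pairs, the definition of the probability over distinct values;
repeated values are reconciled here. -/
theorem sum_values (d : FiniteDist V) (G : ℚ → ℚ) :
    ∑ q ∈ d.values, d.mass q * G q =
      (d.pairs.map fun e => NumberFormat.toRat e.2 * G (NumberFormat.toRat e.1)).sum := by
  -- The finite set is decoupled from the list, so that it stays fixed while the list shrinks.
  have key : ∀ (l : List (V × Fraction)) (s : Finset ℚ),
      (∀ e ∈ l, NumberFormat.toRat e.1 ∈ s) →
      ∑ q ∈ s, ((l.filter fun e => NumberFormat.toRat e.1 = q).map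
        fun e => NumberFormat.toRat e.2).sum * G q =
      (l.map fun e => NumberFormat.toRat e.2 * G (NumberFormat.toRat e.1)).sum := by
    intro l s hs
    induction l with
    | nil => simp
    | cons e l ih =>
      rw [List.map_cons, List.sum_cons, ← ih fun e he => hs e (by simp [he]),
        ← Finset.sum_erase_add _ _ (hs e (by simp)), ← Finset.sum_erase_add _ _ (hs e (by simp))]
      rw [Finset.sum_congr rfl (g := fun q =>
        ((l.filter fun e => NumberFormat.toRat e.1 = q).map
          fun e => NumberFormat.toRat e.2).sum * G q)]
      · simp; ring
      · intro q hq
        rw [List.filter_cons_of_neg]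
        simpa using (Finset.ne_of_mem_erase hq).symm
  exact key _ _ fun e he => List.mem_toFinset.2 (List.mem_map_of_mem he)

theorem sum_piFinset_succ {n : ℕ} (S : Fin (n + 1) → Finset ℚ) (F : (Fin (n + 1) → ℚ) → ℚ) :
    ∑ u ∈ Fintype.piFinset S, F u =
      ∑ q ∈ S 0, ∑ u ∈ Fintype.piFinset fun j => S j.succ, F (Fin.cons q u) := by
  rw [← Finset.sum_product']
  refine Finset.sum_bij' (fun u _ => (u 0, Fin.tail u)) (fun p _ => Fin.cons p.1 p.2) ?_ ?_ ?_ ?_ ?_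
  · intro u hu
    rw [Fintype.mem_piFinset] at hu
    rw [Finset.mem_product, Fintype.mem_piFinset]
    exact ⟨hu 0, fun j => hu j.succ⟩
  · intro p hp
    rw [Finset.mem_product, Fintype.mem_piFinset] at hp
    rw [Fintype.mem_piFinset]
    intro j
    refine Fin.cases ?_ (fun j => ?_) j
    · simpa using hp.1
    · simpa using hp.2 j
  · intro u _; simp
  · intro p _; simp
  · intro u _; simp

end

end PolyTime

namespace PolyTime

open Prec Function Coded

/-- Nonnegativity of probabilities justifies that the parser drops their signs. -/
theorem prob_eq {V : Type} (d : FiniteDist V) {e : V × Fraction} (he : e ∈ d.pairs) :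
    (e.2.num.natAbs : ℚ) / e.2.den.natAbs = NumberFormat.toRat e.2 := by
  have h := d.prob_nonneg e he
  have h' : NumberFormat.toRat e.2 = (e.2.num : ℚ) / e.2.den := rfl
  rw [← abs_of_nonneg h, h', abs_div]
  simp [Nat.cast_natAbs]

section

variable {V : Type} [NumberFormat V] {raw : V → Raw} {dec : Raw → Ratio}

/-- The weighted entries of the columns. -/
def products (raw : V → Raw) (dec : Raw → Ratio) {n : ℕ} (a b w : Fin n → V) : List State :=
  List.ofFn fun j => ((dec (raw (a j))).mul (dec (raw (w j))),
    (dec (raw (b j))).mul (dec (raw (w j))))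

/-- Independence is the splitting of the sum over weight vectors along the first coordinate. The
function `F` sees only rational values, so the outcome may not depend on how a weight is written. -/
theorem expect_decodedColumn (upd : State → State → State) (base : State) {n : ℕ} (a b : Fin n → V)
    (d : Fin n → FiniteDist V) (φ : State → ℕ) (F : (Fin n → ℚ) → ℚ)
    (hF : ∀ w : Fin n → V, (φ ((products raw dec a b w).foldr upd base) : ℚ) =
      F fun j => NumberFormat.toRat (w j)) :
    expect upd base φ (List.ofFn fun j => decodedColumn raw dec (a j) (b j) (d j)) =
      ∑ u ∈ Fintype.piFinset fun j => (d j).values, F u * ∏ j, (d j).mass (u j) := by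
  induction n generalizing φ with
  | zero =>
    have h := hF fun j => j.elim0
    simp only [products, List.ofFn_zero, List.foldr_nil] at h
    simp only [List.ofFn_zero, expect, h, Finset.univ_eq_empty, Finset.prod_empty, mul_one]
    rw [Fintype.piFinset_of_isEmpty, Finset.univ_unique, Finset.sum_singleton]
    congr 1
    exact Subsingleton.elim _ _
  | succ n ih =>
    rw [List.ofFn_succ, expect, sum_piFinset_succ]
    have h₁ : ∀ q, ∑ u ∈ Fintype.piFinset fun j : Fin n => (d j.succ).values,
        F (Fin.cons q u) * ∏ j, (d j).mass ((Fin.cons q u : Fin (n + 1) → ℚ) j) =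
        (d 0).mass q * ∑ u ∈ Fintype.piFinset fun j : Fin n => (d j.succ).values,
          F (Fin.cons q u) * ∏ j, (d j.succ).mass (u j) := by
      intro q
      rw [Finset.mul_sum]
      refine Finset.sum_congr rfl fun u _ => ?_
      rw [Fin.prod_univ_succ]
      simp only [Fin.cons_zero, Fin.cons_succ]
      ring
    simp only [h₁]
    rw [sum_values]
    simp only [decodedColumn, List.map_map]
    congr 1
    refine List.map_congr_left fun e he => ?_
    simp only [comp_apply]
    rw [prob_eq _ he]
    congr 1
    -- Conditioned on the first weight, `F` becomes a function of the remaining ones and `φ` absorbs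
    -- the update by the first column.
    refine ih _ _ _ _ _ fun w => ?_
    have h := hF (Fin.cons e.1 w)
    have h₂ : (fun j => NumberFormat.toRat ((Fin.cons e.1 w : Fin (n + 1) → V) j)) =
        Fin.cons (NumberFormat.toRat e.1) fun j => NumberFormat.toRat (w j) := by
      funext j
      refine Fin.cases rfl (fun j => rfl) j
    rw [h₂] at h
    rw [← h]
    simp [products, List.ofFn_succ]

theorem printFraction_eq (a b : ℕ) (h : (b : ℤ) ≠ 0) :
    printFraction a b = NumberFormat.encode (⟨a, b, h⟩ : Fraction) := by
  simp [printFraction, NumberFormat.encode, encodeBinaryInt]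

/-- The algorithm solves the precedence problem if its final state decides the order of the
rows. -/
theorem precInPolyTime (hread : Reads V raw dec) {upd : State → State → State} {base : State}
    {acc : State → Bool} (h : PT (solve dec upd base acc)) {r : RankingFunction}
    (hr : ∀ (x : Input V) (w : Fin x.cols → V),
      acc ((products raw dec (x.matrix 0) (x.matrix 1) w).foldr upd base) = true ↔
        r 2 x.cols (x.weighted fun j => NumberFormat.toRat (w j)) 0 <
          r 2 x.cols (x.weighted fun j => NumberFormat.toRat (w j)) 1) :
    PrecInPolyTime V r := by
  let t : Input V → List (State × ℕ) × ℕ := fun x => table upd base (columns dec x.encode)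
  have ht : ∀ x, t x = table upd base (List.ofFn fun j =>
      decodedColumn raw dec (x.matrix 0 j) (x.matrix 1 j) (x.dist j)) := fun x => by
    simp only [t, columns_encode hread]
  have hcol : ∀ x : Input V, ∀ c ∈ (List.ofFn fun j =>
      decodedColumn raw dec (x.matrix 0 j) (x.matrix 1 j) (x.dist j)), ∀ v ∈ c.2.2,
      v.2.2 ≠ 0 := by
    intro x c hc v hv
    obtain ⟨j, rfl⟩ := (List.mem_ofFn' _ _).1 hc
    obtain ⟨e, _, rfl⟩ := List.mem_map.1 hv
    exact Int.natAbs_ne_zero.2 e.2.den_ne_zero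
  have hden : ∀ x, ((t x).2 : ℤ) ≠ 0 := fun x => by
    rw [ht]
    exact_mod_cast table_snd upd base _ (hcol x)
  refine ⟨fun x => ⟨weight acc (t x).1, (t x).2, hden x⟩, fun x => ?_,
    h.computable fun x => printFraction_eq _ _ (hden x)⟩
  have hden' : ((t x).2 : ℚ) ≠ 0 := by exact_mod_cast hden x
  change ((weight acc (t x).1 : ℤ) : ℚ) / (((t x).2 : ℤ) : ℚ) = _
  rw [Int.cast_natCast, Int.cast_natCast, div_eq_iff hden', weight_eq_integral, mul_comm, ht,
    integral_table upd base _ _ (hcol x)]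
  congr 1
  rw [expect_decodedColumn upd base _ _ _ _ (fun u =>
    if r 2 x.cols (x.weighted u) 0 < r 2 x.cols (x.weighted u) 1 then 1 else 0)]
  · simp only [Input.precProb, ite_mul, one_mul, zero_mul]
  · intro w
    have := hr x w
    split_ifs with hlt
    · rw [this.2 hlt]; simp
    · rw [Bool.eq_false_iff.2 fun h => hlt (this.1 h)]; simp

end

/-! ### Scores -/

/-- Sorting two rows is either the identity or the exchange; stability keeps tied rows in place,
whence the non-strict inequality. -/
theorem rankByKey_lt {α : Type} [LinearOrder α] (key : Fin 2 → α) :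
    rankByKey key 0 < rankByKey key 1 ↔ key 0 ≤ key 1 := by
  unfold rankByKey
  by_cases h : key 0 ≤ key 1
  · have : Tuple.sort key = Equiv.refl _ := by
      rw [Tuple.sort_eq_refl_iff_monotone, Fin.monotone_iff_le_succ]
      intro i
      fin_cases i
      exact h
    rw [this]
    simpa using h
  · have : Equiv.swap 0 1 = Tuple.sort key := by
      rw [Tuple.eq_sort_iff]
      refine ⟨?_, ?_⟩
      · rw [Fin.monotone_iff_le_succ]
        intro i
        fin_cases i
        simpa using (not_le.1 h).le
      · intro i j hij he
        fin_cases i <;> fin_cases j <;> simp at hij he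
        exact (h he.ge).elim
    rw [← this]
    simpa using not_le.1 h

/-! ### Values of ratios -/

namespace Ratio

theorem mul_val (x y : Ratio) : (x.mul y).val = x.val * y.val := by
  simp only [mul, val]
  push_cast
  rw [div_mul_div_comm]
  ring

theorem mul_pos {x y : Ratio} (hx : 0 < x.2.2) (hy : 0 < y.2.2) : 0 < (x.mul y).2.2 :=
  Nat.mul_pos hx hy

theorem le_iff {x y : Ratio} (hx : 0 < x.2.2) (hy : 0 < y.2.2) :
    x.le y = true ↔ x.val ≤ y.val := by
  have hx' : (0 : ℚ) < x.2.2 := by exact_mod_cast hx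
  have hy' : (0 : ℚ) < y.2.2 := by exact_mod_cast hy
  rw [le, decide_eq_true_iff, val, val, div_le_div_iff₀ hx' hy', ← Nat.cast_le (α := ℚ)]
  push_cast
  constructor <;> intro h <;> linarith

/-- The value of a ratio that may be `-∞`. -/
def botVal (x : Ratio) : WithBot ℚ := if x.2.2 = 0 then ⊥ else (x.val : WithBot ℚ)

/-- Ratios that stand for a number or for `-∞`. -/
def Good (x : Ratio) : Prop := 0 < x.2.2 ∨ x = (0, 1, 0)

/-- The triple for `-∞` is chosen so that cross-multiplication orders it correctly without a case
distinction in the algorithm. -/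
theorem le_iff_botVal {x y : Ratio} (hx : x.Good) (hy : y.Good) :
    x.le y = true ↔ x.botVal ≤ y.botVal := by
  rcases hx with hx | rfl <;> rcases hy with hy | rfl
  · rw [le_iff hx hy, botVal, botVal, if_neg hx.ne', if_neg hy.ne', WithBot.coe_le_coe]
  · simp [le, botVal, hx.ne']
  · simp [le, botVal]
  · simp [le, botVal]

theorem max_good {x y : Ratio} (hx : x.Good) (hy : y.Good) : (x.max y).Good := by
  unfold max
  cases x.le y
  exacts [hx, hy]

theorem max_botVal {x y : Ratio} (hx : x.Good) (hy : y.Good) :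
    (x.max y).botVal = x.botVal ⊔ y.botVal := by
  have h := le_iff_botVal hx hy
  unfold max
  cases hc : x.le y
  · rw [hc] at h
    have h' : ¬ x.botVal ≤ y.botVal := fun h'' => by simpa using h.2 h''
    exact (sup_eq_left.2 (not_le.1 h').le).symm
  · exact (sup_eq_right.2 (h.1 hc)).symm

theorem add_val {x y : Ratio} (hx : 0 < x.2.2) (hy : 0 < y.2.2) :
    (x.add y).val = x.val + y.val := by
  have hx' : (x.2.2 : ℚ) ≠ 0 := by exact_mod_cast hx.ne'
  have hy' : (y.2.2 : ℚ) ≠ 0 := by exact_mod_cast hy.ne'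
  simp only [add, val]
  push_cast
  field_simp
  ring

end Ratio

/-! ### The three update rules and their final states -/

/-- The maxima of scores. -/
def maxScores (x s : State) : State := (s.1.max x.1, s.2.max x.2)

/-- The state with both scores `-∞`. -/
def botScores : State := ((0, 1, 0), (0, 1, 0))

/-- The new scores if they differ, otherwise the old ones. -/
def lexScores (x s : State) : State := bif x.1.le x.2 && x.2.le x.1 then s else x

theorem scoreMax_succ {n : ℕ} (a : Fin (n + 1) → ℚ) :
    scoreMax a = (a 0 : WithBot ℚ) ⊔ scoreMax fun j => a j.succ := by
  unfold scoreMax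
  rw [← Finset.max_insert]
  congr 1
  ext q
  simp [Fin.exists_fin_succ, eq_comm]

theorem foldr_maxScores {n : ℕ} (f g : Fin n → Ratio) (hf : ∀ j, 0 < (f j).2.2)
    (hg : ∀ j, 0 < (g j).2.2) :
    let s := (List.ofFn fun j => (f j, g j)).foldr maxScores botScores
    (s.1.Good ∧ s.1.botVal = scoreMax fun j => (f j).val) ∧
      (s.2.Good ∧ s.2.botVal = scoreMax fun j => (g j).val) := by
  induction n with
  | zero =>
    simp only [List.ofFn_zero, List.foldr_nil]
    exact ⟨⟨.inr rfl, rfl⟩, ⟨.inr rfl, rfl⟩⟩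
  | succ n ih =>
    have ih := ih (fun j => f j.succ) (fun j => g j.succ) (fun j => hf _) fun j => hg _
    simp only [List.ofFn_succ, List.foldr_cons] at ih ⊢
    generalize (List.ofFn fun j : Fin n => (f j.succ, g j.succ)).foldr maxScores botScores = s at *
    have e : ∀ {x : Ratio}, 0 < x.2.2 → (x.val : WithBot ℚ) = x.botVal := fun h => by
      rw [Ratio.botVal, if_neg h.ne']
    obtain ⟨⟨h₁, h₂⟩, h₃, h₄⟩ := ih
    refine ⟨⟨Ratio.max_good h₁ (.inl (hf 0)), ?_⟩, Ratio.max_good h₃ (.inl (hg 0)), ?_⟩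
    · rw [scoreMax_succ, ← h₂, e (hf 0), sup_comm]
      exact Ratio.max_botVal h₁ (.inl (hf 0))
    · rw [scoreMax_succ, ← h₄, e (hg 0), sup_comm]
      exact Ratio.max_botVal h₃ (.inl (hg 0))

theorem foldr_addScores {n : ℕ} (f g : Fin n → Ratio) (hf : ∀ j, 0 < (f j).2.2)
    (hg : ∀ j, 0 < (g j).2.2) :
    let s := (List.ofFn fun j => (f j, g j)).foldr addScores zeroScores
    (0 < s.1.2.2 ∧ s.1.val = scoreSum fun j => (f j).val) ∧
      (0 < s.2.2.2 ∧ s.2.val = scoreSum fun j => (g j).val) := by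
  induction n with
  | zero => simp [zeroScores, Ratio.val, scoreSum]
  | succ n ih =>
    have ih := ih (fun j => f j.succ) (fun j => g j.succ) (fun j => hf _) fun j => hg _
    simp only [List.ofFn_succ, List.foldr_cons] at ih ⊢
    generalize (List.ofFn fun j : Fin n => (f j.succ, g j.succ)).foldr addScores zeroScores = s
      at *
    obtain ⟨⟨h₁, h₂⟩, h₃, h₄⟩ := ih
    refine ⟨⟨Nat.mul_pos h₁ (hf 0), ?_⟩, Nat.mul_pos h₃ (hg 0), ?_⟩
    · rw [addScores, Ratio.add_val h₁ (hf 0), h₂, scoreSum, scoreSum, Fin.sum_univ_succ, add_comm]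
    · rw [addScores, Ratio.add_val h₃ (hg 0), h₄, scoreSum, scoreSum, Fin.sum_univ_succ, add_comm]

/-- Since columns are folded from the right, a column with different entries overrides everything to
its right. The strict order is used because it unfolds one column at a time; two equal rows leave
the tied initial scores. -/
theorem foldr_lexScores {n : ℕ} (f g : Fin n → Ratio) (hf : ∀ j, 0 < (f j).2.2)
    (hg : ∀ j, 0 < (g j).2.2) :
    let s := (List.ofFn fun j => (f j, g j)).foldr lexScores zeroScores
    (0 < s.1.2.2 ∧ 0 < s.2.2.2) ∧
      (s.2.val < s.1.val ↔ toLex (fun j => (g j).val) < toLex fun j => (f j).val) := by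
  induction n with
  | zero =>
    simp only [List.ofFn_zero, List.foldr_nil]
    refine ⟨by simp [zeroScores], ?_⟩
    refine iff_of_false ?_ ?_
    · simp [zeroScores]
    · have e : (fun j : Fin 0 => (g j).val) = fun j => (f j).val := Subsingleton.elim _ _
      rw [e]
      exact lt_irrefl _
  | succ n ih =>
    have ih := ih (fun j => f j.succ) (fun j => g j.succ) (fun j => hf _) fun j => hg _
    simp only [List.ofFn_succ, List.foldr_cons] at ih ⊢
    generalize (List.ofFn fun j : Fin n => (f j.succ, g j.succ)).foldr lexScores zeroScores = s
      at *
    have hlex : toLex (fun j => (g j).val) < toLex (fun j => (f j).val) ↔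
        (g 0).val < (f 0).val ∨ (g 0).val = (f 0).val ∧
          toLex (fun j : Fin n => (g j.succ).val) < toLex fun j => (f j.succ).val := by
      have h := Fin.pi_lex_lt_cons_cons (α := fun _ : Fin (n + 1) => ℚ) (x₀ := (g 0).val)
        (y₀ := (f 0).val) (x := fun j => (g j.succ).val) (y := fun j => (f j.succ).val)
        (fun {_} => (· < ·))
      have e : ∀ k : Fin (n + 1) → Ratio, (Fin.cons (k 0).val fun j : Fin n => (k j.succ).val :
          Fin (n + 1) → ℚ) = fun j => (k j).val := fun k => by
        funext j
        exact Fin.cases rfl (fun j => rfl) j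
      rw [e, e] at h
      exact h
    rw [hlex]
    have h₁ := Ratio.le_iff (hf 0) (hg 0)
    have h₂ := Ratio.le_iff (hg 0) (hf 0)
    unfold lexScores
    by_cases heq : (g 0).val = (f 0).val
    · rw [h₁.2 heq.ge, h₂.2 heq.le]
      simpa [heq] using ih
    · have : ((f 0).le (g 0) && (g 0).le (f 0)) = false := by
        rw [Bool.eq_false_iff]
        intro h
        rw [Bool.and_eq_true, h₁, h₂] at h
        exact heq (le_antisymm h.2 h.1)
      simp [this, heq, hf 0, hg 0]

/-! ### The four ranking functions -/

section

variable {V : Type} [NumberFormat V] {raw : V → Raw} {dec : Raw → Ratio}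

theorem products_spec (h : Reads V raw dec) {n : ℕ} (a w : Fin n → V) :
    (∀ j, 0 < ((dec (raw (a j))).mul (dec (raw (w j)))).2.2) ∧
      (fun j => ((dec (raw (a j))).mul (dec (raw (w j)))).val) =
        fun j => NumberFormat.toRat (a j) * NumberFormat.toRat (w j) :=
  ⟨fun _ => Ratio.mul_pos (h.pos _) (h.pos _), by
    funext j; rw [Ratio.mul_val, h.val_eq, h.val_eq]⟩

theorem max_correct (h : Reads V raw dec) (x : Input V) (w : Fin x.cols → V) :
    let s := (products raw dec (x.matrix 0) (x.matrix 1) w).foldr maxScores botScores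
    (s.1.Good ∧ s.1.botVal = scoreMax (x.weighted (fun j => NumberFormat.toRat (w j)) 0)) ∧
      (s.2.Good ∧ s.2.botVal = scoreMax (x.weighted (fun j => NumberFormat.toRat (w j)) 1)) := by
  obtain ⟨h₁, h₂⟩ := products_spec h (x.matrix 0) w
  obtain ⟨h₃, h₄⟩ := products_spec h (x.matrix 1) w
  have := foldr_maxScores _ _ h₁ h₃
  rw [h₂, h₄] at this
  exact this

theorem precInPolyTime_maxAsc (h : Reads V raw dec) (hdec : PT dec) :
    PrecInPolyTime V rankMaxAsc := by
  refine precInPolyTime h (upd := maxScores) (base := botScores) (acc := fun s => s.1.le s.2)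
    (PT.solve_of_mem hdec (by unfold maxScores; fun_prop) (by fun_prop) ?_) fun x w => ?_
  · intro x s
    simp only [maxScores, Ratio.max]
    cases s.1.le x.1 <;> cases s.2.le x.2 <;> simp
  · obtain ⟨⟨h₁, h₂⟩, h₃, h₄⟩ := max_correct h x w
    rw [rankMaxAsc, rankByKey_lt, ← h₂, ← h₄]
    exact Ratio.le_iff_botVal h₁ h₃

theorem precInPolyTime_maxDsc (h : Reads V raw dec) (hdec : PT dec) :
    PrecInPolyTime V rankMaxDsc := by
  refine precInPolyTime h (upd := maxScores) (base := botScores) (acc := fun s => s.2.le s.1)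
    (PT.solve_of_mem hdec (by unfold maxScores; fun_prop) (by fun_prop) ?_) fun x w => ?_
  · intro x s
    simp only [maxScores, Ratio.max]
    cases s.1.le x.1 <;> cases s.2.le x.2 <;> simp
  · obtain ⟨⟨h₁, h₂⟩, h₃, h₄⟩ := max_correct h x w
    rw [rankMaxDsc, rankByKey_lt, ← h₂, ← h₄]
    exact Ratio.le_iff_botVal h₃ h₁

theorem precInPolyTime_lex (h : Reads V raw dec) (hdec : PT dec) :
    PrecInPolyTime V rankLex := by
  refine precInPolyTime h (upd := lexScores) (base := zeroScores) (acc := fun s => s.1.le s.2)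
    (PT.solve_of_mem hdec (by unfold lexScores; fun_prop) (by fun_prop) ?_) fun x w => ?_
  · intro x s
    simp only [lexScores]
    cases x.1.le x.2 && x.2.le x.1 <;> simp
  · obtain ⟨h₁, h₂⟩ := products_spec h (x.matrix 0) w
    obtain ⟨h₃, h₄⟩ := products_spec h (x.matrix 1) w
    have := foldr_lexScores _ _ h₁ h₃
    rw [h₂, h₄] at this
    -- The fold characterizes when the second row is strictly smaller; the first row precedes
    -- exactly when this fails.
    rw [rankLex, rankByKey_lt, ← not_lt]
    refine (Ratio.le_iff this.1.1 this.1.2).trans ?_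
    rw [← not_lt]
    exact not_congr this.2

theorem precInPolyTime_sum : PrecInPolyTime UnaryInt rankSum := by
  refine precInPolyTime reads_unary (acc := fun s => s.1.le s.2)
    (PT.solve_addScores (by fun_prop)) fun x w => ?_
  obtain ⟨h₁, h₂⟩ := products_spec reads_unary (x.matrix 0) w
  obtain ⟨h₃, h₄⟩ := products_spec reads_unary (x.matrix 1) w
  have := foldr_addScores _ _ h₁ h₃
  rw [h₂, h₄] at this
  obtain ⟨⟨i₁, i₂⟩, i₃, i₄⟩ := this
  rw [rankSum, rankByKey_lt]
  refine (Ratio.le_iff i₁ i₃).trans ?_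
  rw [i₂, i₄]
  rfl

end

end PolyTime

theorem mainTheorem1 :
    Prec.PrecInPolyTime Prec.Fraction Prec.rankMaxAsc ∧
    Prec.PrecInPolyTime Prec.Fraction Prec.rankMaxDsc ∧
    Prec.PrecInPolyTime Prec.Fraction Prec.rankLex ∧
    Prec.PrecInPolyTime Prec.UnaryInt Prec.rankSum :=
  ⟨PolyTime.precInPolyTime_maxAsc PolyTime.reads_fraction PolyTime.PT.decodeFraction,
    PolyTime.precInPolyTime_maxDsc PolyTime.reads_fraction PolyTime.PT.decodeFraction,
    PolyTime.precInPolyTime_lex PolyTime.reads_fraction PolyTime.PT.decodeFraction,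
    PolyTime.precInPolyTime_sum⟩
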